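/- Let $M$ be a closed oriented topological $3$-manifold, let $K\subset M$ be a (tame, unoriented) knot, let $N(K)$ be a regular neighbourhood of $K$ (a closed solid torus $D^2\times S^1$ with core $K$, embedded so that the embedding extends to an open embedding of $\mathbb{R}^2\times S^1$), and let $E(K)=M-\operatorname{int}N(K)$ be the exterior of $K$. A slope is an isotopy class of unoriented loops on $\partial N(K)$ which are images of the meridian $\partial D^2\times\{1\}$ under a homeomorphism $f:\partial D^2\times S^1\to\partial N(K)$. For a slope $r$, $r$-surgery on $K$ yields the manifold $E(K)\cup_f(D^2\times S^1)$, where $f(\partial D^2\times\{1\})$ represents $r$, oriented so that its orientation agrees with that of $M$ on the interior of $E(K)$. The meridional slope is the class of the meridian of $N(K)$. Two knots in $M$ are equivalent if an orientation-preserving homeomorphism of $M$ takes one to the other. Let $k\ge 0$ be an integer, and suppose that there are at most $k$ distinct non-meridional slopes $r$ such that $r$-surgery on $K$ yields a manifold orientation-preservingly homeomorphic to $M$. Then, up to equivalence, there are at most $k$ knots $K'$ in $M$ that are inequivalent to $K$ but whose exteriors are orientation-preservingly homeomorphic to the exterior of $K$; that is, every set of pairwise inequivalent such knots $K'$ has at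 most $k$ elements. -/

import Mathlib

open Set Filter Topology

namespace KnotSurgery

/-! ### Oriented topological 3-manifolds -/

/-- Euclidean 3-space. -/
abbrev E3 : Type := EuclideanSpace ℝ (Fin 3)

/-- The unit 2-sphere. -/
abbrev S2 : Type := Metric.sphere (0 : E3) 1

/-- The map `g : S² → ℝ³ ∖ {0}` is homotopic in `ℝ³ ∖ {0}` to the inclusion; equivalently
(Hopf), `g` is continuous, avoids `0`, and has degree one. -/
def HomotopicToInclusion (g : S2 → E3) : Prop :=
  ∃ H : C(unitInterval × S2, E3),
    (∀ z, H z ≠ 0) ∧ (∀ v, H (0, v) = g v) ∧ ∀ v : S2, H (1, v) = v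

/-- `F` has local degree one at `p`: on every sufficiently small sphere centred at `p`, the map
`v ↦ F (p + r v) - F p` has degree one.  For a local homeomorphism `F` of `ℝ³` this says that
`F` preserves the orientation at `p`. -/
def DegreeOneAt (F : E3 → E3) (p : E3) : Prop :=
  ∀ᶠ r in 𝓝[>] (0 : ℝ), HomotopicToInclusion fun v => F (p + r • (v : E3)) - F p

/-- An orientation of a topological 3-manifold (without boundary), given by an atlas of charts in
`ℝ³` all of whose coordinate changes preserve the orientation. -/
structure OrientedAtlas (X : Type*) [TopologicalSpace X] where
  charts : Set (OpenPartialHomeomorph X E3)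
  cover : ∀ x : X, ∃ φ ∈ charts, x ∈ φ.source
  compatible : ∀ φ ∈ charts, ∀ ψ ∈ charts, ∀ x ∈ φ.source ∩ ψ.source,
    DegreeOneAt (fun p => ψ (φ.symm p)) (φ x)

/-- For maps `i : U → X` and `j : U → Y` that are open embeddings near `u`, the local
homeomorphism `j ∘ i⁻¹` from `X` to `Y` preserves the orientation at `i u`.  In the charts
`φ`, `ψ` this map is `ψ ∘ j ∘ i⁻¹ ∘ φ⁻¹`; only its values near `φ (i u)` matter, and the value
`0` outside the range of `i` is a dummy. -/
def PreservesOrientationAt {U X Y : Type*} [TopologicalSpace X] [TopologicalSpace Y]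
    (oX : OrientedAtlas X) (oY : OrientedAtlas Y) (i : U → X) (j : U → Y) (u : U) : Prop :=
  ∀ φ ∈ oX.charts, i u ∈ φ.source → ∀ ψ ∈ oY.charts, j u ∈ ψ.source →
    DegreeOneAt (fun p => Function.extend i (fun w => ψ (j w)) 0 (φ.symm p)) (φ (i u))

/-- A homeomorphism between oriented 3-manifolds is orientation-preserving. -/
def OrientationPreserving {X Y : Type*} [TopologicalSpace X] [TopologicalSpace Y]
    (oX : OrientedAtlas X) (oY : OrientedAtlas Y) (g : X ≃ₜ Y) : Prop :=
  ∀ x, PreservesOrientationAt oX oY id g x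

/-! ### Knots, tubular neighbourhoods, exteriors -/

/-- A (tame, unoriented) knot: a subset that is the core circle `0 × S¹` of an open embedding of
`ℝ² × S¹`. -/
structure Knot (M : Type*) [TopologicalSpace M] where
  carrier : Set M
  tame : ∃ e : ℂ × Circle → M, IsOpenEmbedding e ∧ e '' ({0} ×ˢ univ) = carrier

/-- Two knots are equivalent if an orientation-preserving homeomorphism of the ambient manifold
takes one to the other. -/
def Knot.Equivalent {M : Type*} [TopologicalSpace M] (o : OrientedAtlas M) (K₁ K₂ : Knot M) :
    Prop :=
  ∃ g : M ≃ₜ M, OrientationPreserving o o g ∧ g '' K₁.carrier = K₂.carrier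

/-- A (parametrized, collared) regular neighbourhood `N(K)` of `K`.  The closed solid torus `N(K)`
is the image of `D² × S¹`, where `D²` is the closed unit disc in `ℂ = ℝ²`. -/
structure TubularNbhd {M : Type*} [TopologicalSpace M] (K : Knot M) where
  param : ℂ × Circle → M
  isOpenEmbedding : IsOpenEmbedding param
  core : param '' ({0} ×ˢ univ) = K.carrier

namespace TubularNbhd

variable {M : Type*} [TopologicalSpace M] {K : Knot M} (N : TubularNbhd K)

/-- The exterior `M - int N(K)`. -/
def exterior : Set M := (N.param '' (Metric.ball 0 1 ×ˢ univ))ᶜ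

/-- The restriction of the parametrization to the torus `∂D² × S¹`. -/
def boundaryParam (p : Circle × Circle) : M := N.param ((p.1 : ℂ), p.2)

/-- The boundary torus `∂N(K)`, which is also the boundary of the exterior. -/
def boundary : Set M := range N.boundaryParam

theorem isEmbedding_boundaryParam : IsEmbedding N.boundaryParam :=
  N.isOpenEmbedding.isEmbedding.comp
    (IsEmbedding.subtypeVal.prodMap IsEmbedding.id)

theorem boundary_subset_exterior : N.boundary ⊆ N.exterior := by
  rintro _ ⟨p, rfl⟩ ⟨q, hq, h⟩
  have hqp := N.isOpenEmbedding.injective h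
  have h1 := hq.1
  rw [hqp] at h1
  simp [Circle.norm_coe] at h1

/-! ### Slopes -/

/-- A gluing map for Dehn surgery: a homeomorphism from the boundary `∂D² × S¹` of the solid torus
to `∂N(K)`. -/
abbrev GluingMap : Type _ := (Circle × Circle) ≃ₜ N.boundary

variable {N} in
/-- The loop on `∂N(K)` that a gluing map identifies with the meridian `∂D² × {1}` of the attached
solid torus. -/
def GluingMap.meridianImage (f : N.GluingMap) : Set N.boundary := f '' (univ ×ˢ {1})

/-- The (unoriented) loops on `∂N(K)` that can be identified with the meridian of an attached solid
torus; these are the essential simple closed curves on the torus. -/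
def SlopeCurve : Type _ := {C : Set N.boundary // ∃ f : N.GluingMap, f.meridianImage = C}

/-- Isotopy of curves on a space: some ambient isotopy carries the first to the second. -/
def IsIsotopic {T : Type*} [TopologicalSpace T] (C C' : Set T) : Prop :=
  ∃ H : unitInterval → (T ≃ₜ T),
    Continuous (fun p : unitInterval × T => H p.1 p.2) ∧
      H 0 = Homeomorph.refl T ∧ H 1 '' C = C'

theorem isIsotopic_equivalence {T : Type*} [TopologicalSpace T] :
    Equivalence (IsIsotopic (T := T)) where
  refl C := ⟨fun _ => Homeomorph.refl T, continuous_snd, rfl, by simp⟩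
  symm := by
    rintro C C' ⟨H, hH, h0, rfl⟩
    refine ⟨fun t => (H 1).symm.trans (H (unitInterval.symm t)), ?_, ?_, ?_⟩
    · exact hH.comp ((unitInterval.continuous_symm.comp continuous_fst).prodMk
        ((H 1).symm.continuous.comp continuous_snd))
    · ext x; simp
    · ext x; simp [h0]
  trans := by
    rintro C C' C'' ⟨H, hH, h0, rfl⟩ ⟨G, hG, g0, rfl⟩
    refine ⟨fun t => (H t).trans (G t), ?_, ?_, ?_⟩
    · exact hG.comp (continuous_fst.prodMk hH)
    · ext x; simp [h0, g0]
    · exact image_comp (G 1) (H 1) C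

instance slopeSetoid : Setoid N.SlopeCurve where
  r C C' := IsIsotopic C.1 C'.1
  iseqv := ⟨fun C => isIsotopic_equivalence.refl C.1, fun h => isIsotopic_equivalence.symm h,
    fun h h' => isIsotopic_equivalence.trans h h'⟩

/-- A slope on `∂N(K)`: an isotopy class of loops that can serve as the meridian of an attached
solid torus. -/
def Slope : Type _ := Quotient N.slopeSetoid

variable {N} in
/-- The surgery slope determined by a gluing map. -/
def GluingMap.slope (f : N.GluingMap) : N.Slope :=
  Quotient.mk N.slopeSetoid ⟨f.meridianImage, f, rfl⟩

/-- The gluing map that puts the solid torus `N(K)` back. -/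
noncomputable def trivialGluing : N.GluingMap := N.isEmbedding_boundaryParam.toHomeomorph

/-- The meridional slope: the isotopy class of `∂D² × {1}` in `∂N(K)`. -/
noncomputable def meridionalSlope : N.Slope := GluingMap.slope N.trivialGluing

/-! ### Dehn surgery -/

/-- The solid torus `D² × S¹`. -/
abbrev SolidTorus : Type := Metric.closedBall (0 : ℂ) 1 × Circle

/-- The inclusion of `∂D² × S¹` in `D² × S¹`. -/
def solidTorusBoundary (p : Circle × Circle) : SolidTorus := (⟨p.1, by simp [Circle.norm_coe]⟩, p.2)

/-- The identification of each boundary point `p` of the solid torus with `f p ∈ ∂N(K)`. -/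
def glueRel (f : N.GluingMap) (a b : N.exterior ⊕ SolidTorus) : Prop :=
  ∃ p : Circle × Circle,
    a = Sum.inl ⟨f p, N.boundary_subset_exterior (f p).2⟩ ∧ b = Sum.inr (solidTorusBoundary p)

/-- The result `(M - int N(K)) ∪_f (D² × S¹)` of Dehn surgery on `K` with gluing map `f`, with the
quotient topology. -/
abbrev Surgery (f : N.GluingMap) : Type _ := Quot (N.glueRel f)

/-- The canonical map from the exterior of `K` to the surgered manifold. -/
def toSurgery (f : N.GluingMap) (x : N.exterior) : N.Surgery f := Quot.mk _ (Sum.inl x)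

/-- `o'` is the orientation of the surgered manifold induced by the orientation `o` of `M`: the two
agree on the interior of the exterior of `K`. -/
def IsInducedOrientation (o : OrientedAtlas M) (f : N.GluingMap)
    (o' : OrientedAtlas (N.Surgery f)) : Prop :=
  ∀ x : N.exterior, (x : M) ∉ N.boundary →
    PreservesOrientationAt o o' Subtype.val (N.toSurgery f) x

/-- `r`-surgery on `K` yields a manifold orientation-preservingly homeomorphic to `M`. -/
def SurgeryYieldsAmbient (o : OrientedAtlas M) (r : N.Slope) : Prop :=
  ∃ f : N.GluingMap, f.slope = r ∧
    ∃ o' : OrientedAtlas (N.Surgery f), N.IsInducedOrientation o f o' ∧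
      ∃ g : N.Surgery f ≃ₜ M, OrientationPreserving o' o g

/-- The exteriors given by the regular neighbourhoods `N'` and `N` are homeomorphic, as manifolds
with boundary, by an orientation-preserving homeomorphism: a homeomorphism under which boundary
points correspond to boundary points (as is always so, by invariance of domain) and which preserves
the orientation at every interior point. -/
def ExteriorsHomeomorphic (o : OrientedAtlas M) {K' : Knot M} (N' : TubularNbhd K')
    {K : Knot M} (N : TubularNbhd K) : Prop :=
  ∃ h : N'.exterior ≃ₜ N.exterior,
    (∀ x, (h x : M) ∈ N.boundary ↔ (x : M) ∈ N'.boundary) ∧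
      ∀ x : N'.exterior, (x : M) ∉ N'.boundary →
        PreservesOrientationAt o o Subtype.val (fun y => (h y : M)) x

end TubularNbhd

end KnotSurgery

/-!
Two knots with the same exterior differ only in how the solid torus is glued in.  Let `K'` be a knot
whose exterior is identified with that of `K` by `h`.  Transporting the meridian of `K'` by `h`
gives a slope on `∂N(K)` (`HasMeridianSlope`), and surgery on `K` along this slope is
`E(K) ∪ N(K') ≅ E(K') ∪ N(K') = M` (`surgeryHomeo`, `HasMeridianSlope.surgeryYieldsAmbient`).  The
theorem follows because the slope determines the knot up to equivalence
(`HasMeridianSlope.equivalent`): slopes of inequivalent knots are distinct, and they are different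
from the meridional slope, which is the slope of `K` itself.

If two knots have the same slope, then the identification of their exteriors restricts to a torus
homeomorphism that takes meridian to meridian up to isotopy.  Such a homeomorphism extends over the
solid torus and preserves the core (`ExtendsOver.of_isIsotopic`).  The isotopy is absorbed by
concentric tori, and coning discs reduces the problem to a homeomorphism that fixes the meridian
pointwise.  If this exchanges the two sides of the meridian, it is composed with a reflection.  Then
the torus cut open along the meridian is an annulus `S¹ × [-1, 1]` with a homeomorphism fixing the
boundary pointwise, and the Alexander trick applies: the map is extended by the identity to
`S¹ × ℝ` and then homogeneously to `ℂ × ℝ`.  The extension is the identity on the discs at heights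
`±1`, so it descends to the solid torus.

For orientations no computation of degrees is needed.  The local degree one condition is
multiplicative (`DegreeOneAt.comp`), invariant under inversion (`DegreeOneAt.symm`) and locally
constant (`DegreeOneAt.eventually_iff`).  Since the homeomorphism of `M` preserves the orientation
in the interior of the exterior, and the open solid torus is connected and meets this interior, the
homeomorphism preserves the orientation everywhere.
-/

namespace KnotSurgery

/-! ### The local degree one condition -/

/-- The punctured open ball of radius `ρ` about the origin of `ℝ³`. -/
abbrev PuncturedBall (ρ : ℝ) : Type := {x : E3 // x ≠ 0 ∧ ‖x‖ < ρ}

/-- The punctured space `ℝ³ ∖ {0}`. -/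
abbrev PuncturedSpace : Type := {x : E3 // x ≠ 0}

/-- The inclusion of a punctured ball in the punctured space. -/
def PuncturedBall.incl (ρ : ℝ) : C(PuncturedBall ρ, PuncturedSpace) where
  toFun x := ⟨x.1, x.2.1⟩
  continuous_toFun := by fun_prop

/-- The inclusion of the sphere of radius `r`, parametrized by the unit sphere, in the punctured
ball of radius `ρ`. -/
def sphereIncl {r ρ : ℝ} (hr : 0 < r) (hρ : r < ρ) : C(S2, PuncturedBall ρ) where
  toFun v := ⟨r • (v : E3), by
    have h1 : ‖(v : E3)‖ = 1 := by simp
    refine ⟨fun h => ?_, ?_⟩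
    · have := congrArg norm h
      rw [norm_smul, h1] at this
      simp at this
      exact hr.ne' this
    · rw [norm_smul, h1, Real.norm_of_nonneg hr.le]; simpa using hρ⟩
  continuous_toFun := by fun_prop

/-- The inclusion of the unit sphere in the punctured space. -/
def unitSphereIncl : C(S2, PuncturedSpace) where
  toFun v := ⟨v, fun h => by have := v.2; simp [h] at this⟩
  continuous_toFun := by fun_prop

theorem sphereIncl_homotopic {r r' ρ : ℝ} (hr : 0 < r) (hρ : r < ρ) (hr' : 0 < r') (hρ' : r' < ρ) :
    (sphereIncl hr hρ).Homotopic (sphereIncl hr' hρ') := by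
  have hpos (t : unitInterval) : 0 < (1 - (t : ℝ)) * r + t * r' := by
    rcases eq_or_lt_of_le t.2.1 with h | h
    · rw [← h]; simpa using hr
    · have : 0 ≤ (1 - (t : ℝ)) * r := mul_nonneg (by linarith [t.2.2]) hr.le
      have := mul_pos h hr'
      linarith
  have hlt (t : unitInterval) : (1 - (t : ℝ)) * r + t * r' < ρ := by
    rcases eq_or_lt_of_le t.2.1 with h | h
    · rw [← h]; simpa using hρ
    · have : (1 - (t : ℝ)) * r ≤ (1 - (t : ℝ)) * ρ :=
        mul_le_mul_of_nonneg_left hρ.le (by linarith [t.2.2])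
      have := mul_lt_mul_of_pos_left hρ' h
      linarith
  refine ⟨⟨⟨fun z => ⟨((1 - (z.1 : ℝ)) * r + z.1 * r') • (z.2 : E3),
    (sphereIncl (hpos z.1) (hlt z.1) z.2).2⟩, by fun_prop⟩, fun v => ?_, fun v => ?_⟩⟩
  · ext1; simp [sphereIncl]
  · ext1; simp [sphereIncl]

theorem incl_sphereIncl_homotopic {r ρ : ℝ} (hr : 0 < r) (hρ : r < ρ) :
    ((PuncturedBall.incl ρ).comp (sphereIncl hr hρ)).Homotopic unitSphereIncl := by
  have h := sphereIncl_homotopic hr (lt_max_of_lt_left hρ : r < max ρ 2) one_pos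
    (lt_max_of_lt_right one_lt_two : 1 < max ρ 2)
  have h' := (ContinuousMap.Homotopic.refl (PuncturedBall.incl (max ρ 2))).comp h
  convert h' using 1 <;>
  · ext1 v; ext1; simp [PuncturedBall.incl, sphereIncl, unitSphereIncl]

/-- The inclusion of a punctured ball in the punctured space is a homotopy equivalence; only its
injectivity on homotopy classes is needed. -/
theorem PuncturedBall.homotopic_of_incl {A : Type*} [TopologicalSpace A] {ρ : ℝ} (hρ : 0 < ρ)
    {a b : C(A, PuncturedBall ρ)}
    (h : ((PuncturedBall.incl ρ).comp a).Homotopic ((PuncturedBall.incl ρ).comp b)) :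
    a.Homotopic b := by
  have hd (t : ℝ) (ht : 0 ≤ t) (x : E3) : 0 < ρ + t * ‖x‖ := by positivity
  -- a homotopy inverse of the inclusion, which shrinks vectors radially
  let s : C(PuncturedSpace, PuncturedBall ρ) :=
    ⟨fun x => ⟨(ρ / (ρ + 1 * ‖x.1‖)) • x.1,
      smul_ne_zero (div_pos hρ (hd 1 zero_le_one _)).ne' x.2, by
      rw [norm_smul, Real.norm_of_nonneg (div_pos hρ (hd 1 zero_le_one _)).le, div_mul_eq_mul_div,
        div_lt_iff₀ (hd 1 zero_le_one _)]
      nlinarith⟩, by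
      refine Continuous.subtype_mk (Continuous.smul (Continuous.div (by fun_prop) (by fun_prop)
        fun x => (hd 1 zero_le_one _).ne') (by fun_prop)) _⟩
  have hs : (ContinuousMap.id _).Homotopic (s.comp (PuncturedBall.incl ρ)) := by
    refine ⟨⟨⟨fun z => ⟨(ρ / (ρ + z.1 * ‖z.2.1‖)) • z.2.1,
      smul_ne_zero (div_pos hρ (hd _ z.1.2.1 _)).ne' z.2.2.1, ?_⟩, ?_⟩, fun x => ?_, fun x => ?_⟩⟩
    · rw [norm_smul, Real.norm_of_nonneg (div_pos hρ (hd _ z.1.2.1 _)).le]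
      refine lt_of_le_of_lt (mul_le_of_le_one_left (norm_nonneg _) ?_) z.2.2.2
      rw [div_le_one (hd _ z.1.2.1 _)]
      have := mul_nonneg z.1.2.1 (norm_nonneg z.2.1)
      linarith
    · refine Continuous.subtype_mk (Continuous.smul (Continuous.div (by fun_prop) (by fun_prop)
        fun x => (hd _ x.1.2.1 _).ne') (by fun_prop)) _
    · ext1; simp [hρ.ne']
    · ext1; simp [s, PuncturedBall.incl]
  have h1 (c : C(A, PuncturedBall ρ)) :
      c.Homotopic (s.comp ((PuncturedBall.incl ρ).comp c)) :=
    hs.comp (ContinuousMap.Homotopic.refl c)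
  exact (h1 a).trans (((ContinuousMap.Homotopic.refl s).comp h).trans (h1 b).symm)

theorem homotopicToInclusion_iff (g : C(S2, PuncturedSpace)) :
    HomotopicToInclusion (fun v => (g v : E3)) ↔ g.Homotopic unitSphereIncl := by
  constructor
  · rintro ⟨H, h0, h1, h2⟩
    refine ⟨⟨⟨fun z => ⟨H z, h0 z⟩, by fun_prop⟩, fun v => ?_, fun v => ?_⟩⟩
    · ext1; exact h1 v
    · ext1; exact h2 v
  · rintro ⟨H⟩
    exact ⟨⟨fun z => (H z).1, by fun_prop⟩, fun z => (H z).2, fun v => by simp,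
      fun v => congrArg Subtype.val (H.apply_one v)⟩

section

variable {e : OpenPartialHomeomorph E3 E3} {p : E3} {R ρ : ℝ}

/-- The displacement map `x ↦ e (p + x) - e p` of a local homeomorphism, between punctured
balls. -/
def displacement (e : OpenPartialHomeomorph E3 E3) (p : E3) (R ρ : ℝ)
    (h : Metric.ball p R ⊆ e.source) (hρ : MapsTo e (Metric.ball p R) (Metric.ball (e p) ρ)) :
    C(PuncturedBall R, PuncturedBall ρ) where
  toFun x := ⟨e (p + x) - e p, by
    have hx : p + x ∈ Metric.ball p R := by simpa using x.2.2
    have hR : 0 < R := (norm_nonneg _).trans_lt x.2.2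
    refine ⟨fun h0 => x.2.1 ?_, by simpa [dist_eq_norm] using hρ hx⟩
    simpa using e.injOn (h hx) (h (Metric.mem_ball_self hR)) (sub_eq_zero.1 h0)⟩
  continuous_toFun := by
    refine Continuous.subtype_mk (Continuous.sub (e.continuousOn.comp_continuous (by fun_prop)
      fun x => h (by simpa using x.2.2)) continuous_const) _

theorem homotopicToInclusion_iff_displacement (h : Metric.ball p R ⊆ e.source)
    (hρ : MapsTo e (Metric.ball p R) (Metric.ball (e p) ρ)) {r s : ℝ} (hr : 0 < r) (hrR : r < R)
    (hs : 0 < s) (hsρ : s < ρ) :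
    HomotopicToInclusion (fun v => e (p + r • (v : E3)) - e p) ↔
      ((displacement e p R ρ h hρ).comp (sphereIncl hr hrR)).Homotopic (sphereIncl hs hsρ) := by
  have h1 := homotopicToInclusion_iff
    ((PuncturedBall.incl ρ).comp ((displacement e p R ρ h hρ).comp (sphereIncl hr hrR)))
  refine h1.trans ⟨fun h2 => PuncturedBall.homotopic_of_incl (hs.trans hsρ)
    (h2.trans (incl_sphereIncl_homotopic hs hsρ).symm), fun h2 => ?_⟩
  exact ((ContinuousMap.Homotopic.refl _).comp h2).trans (incl_sphereIncl_homotopic hs hsρ)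

theorem homotopicToInclusion_radius (h : Metric.ball p R ⊆ e.source) {r r' : ℝ} (hr : 0 < r)
    (hrR : r < R) (hr' : 0 < r') (hrR' : r' < R)
    (H : HomotopicToInclusion (fun v => e (p + r • (v : E3)) - e p)) :
    HomotopicToInclusion (fun v => e (p + r' • (v : E3)) - e p) := by
  -- on a slightly smaller closed ball the map `e` is bounded
  obtain ⟨R', h1, h2⟩ := exists_between (max_lt hrR hrR')
  have hc : IsCompact (e '' Metric.closedBall p R') :=
    (isCompact_closedBall p R').image_of_continuousOn
      (e.continuousOn.mono ((Metric.closedBall_subset_ball h2).trans h))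
  obtain ⟨ρ, hρ0, hρ⟩ := hc.isBounded.subset_ball_lt 0 (e p)
  have hm : MapsTo e (Metric.ball p R') (Metric.ball (e p) ρ) := fun x hx =>
    hρ ⟨x, Metric.ball_subset_closedBall hx, rfl⟩
  have hb : Metric.ball p R' ⊆ e.source := (Metric.ball_subset_ball h2.le).trans h
  have a1 := (le_max_left r r').trans_lt h1
  have a2 := (le_max_right r r').trans_lt h1
  rw [homotopicToInclusion_iff_displacement hb hm hr a1 (half_pos hρ0) (half_lt_self hρ0)] at H
  rw [homotopicToInclusion_iff_displacement hb hm hr' a2 (half_pos hρ0) (half_lt_self hρ0)]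
  exact ((ContinuousMap.Homotopic.refl _).comp (sphereIncl_homotopic hr' a2 hr a1)).trans H

theorem degreeOneAt_iff (h : Metric.ball p R ⊆ e.source) {r : ℝ} (hr : 0 < r) (hrR : r < R) :
    DegreeOneAt e p ↔ HomotopicToInclusion (fun v => e (p + r • (v : E3)) - e p) := by
  have hR := hr.trans hrR
  constructor
  · intro H
    obtain ⟨r', h1, h2⟩ := (H.and (Ioo_mem_nhdsGT hR)).exists
    exact homotopicToInclusion_radius h h2.1 h2.2 hr hrR h1
  · intro H
    filter_upwards [Ioo_mem_nhdsGT hR] with r' hr'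
    exact homotopicToInclusion_radius h hr hrR hr'.1 hr'.2 H

end

theorem DegreeOneAt.congr {F G : E3 → E3} {p : E3} (hF : DegreeOneAt F p) (h : F =ᶠ[𝓝 p] G) :
    DegreeOneAt G p := by
  obtain ⟨R, hR, hb⟩ := Metric.eventually_nhds_iff_ball.1 h
  filter_upwards [hF, Ioo_mem_nhdsGT hR] with r hr hr'
  convert hr using 2 with v
  rw [hb p (Metric.mem_ball_self hR), hb]
  have h1 : ‖(v : E3)‖ = 1 := by simp
  simp [norm_smul, h1, abs_of_pos hr'.1, hr'.2]

theorem degreeOneAt_congr {F G : E3 → E3} {p : E3} (h : F =ᶠ[𝓝 p] G) :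
    DegreeOneAt F p ↔ DegreeOneAt G p :=
  ⟨fun hF => hF.congr h, fun hG => hG.congr h.symm⟩

/-- A ball around `p` in the source of `e` that `e` maps into a prescribed ball. -/
theorem exists_ball_mapsTo (e : OpenPartialHomeomorph E3 E3) {p : E3} (hp : p ∈ e.source) {ρ : ℝ}
    (hρ : 0 < ρ) : ∃ R > 0, Metric.ball p R ⊆ e.source ∧
      MapsTo e (Metric.ball p R) (Metric.ball (e p) ρ) := by
  have h := inter_mem (e.open_source.mem_nhds hp)
    (e.continuousAt hp (Metric.ball_mem_nhds (e p) hρ))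
  obtain ⟨R, hR, hb⟩ := Metric.mem_nhds_iff.1 h
  exact ⟨R, hR, fun x hx => (hb hx).1, fun x hx => (hb hx).2⟩

theorem DegreeOneAt.comp {e e' : OpenPartialHomeomorph E3 E3} {p : E3} (hp : p ∈ e.source)
    (hp' : e p ∈ e'.source) (h : DegreeOneAt e p) (h' : DegreeOneAt e' (e p)) :
    DegreeOneAt (e.trans e') p := by
  obtain ⟨ρ, hρ, hb', hm'⟩ := exists_ball_mapsTo e' hp' one_pos
  obtain ⟨R, hR, hb, hm⟩ := exists_ball_mapsTo e hp hρ
  have hs : Metric.ball p R ⊆ (e.trans e').source := by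
    rw [OpenPartialHomeomorph.trans_source]
    exact fun x hx => ⟨hb hx, hb' (hm hx)⟩
  have hms : MapsTo (e.trans e') (Metric.ball p R) (Metric.ball (e.trans e' p) 1) :=
    fun x hx => hm' (hm hx)
  rw [degreeOneAt_iff hb (half_pos hR) (half_lt_self hR),
    homotopicToInclusion_iff_displacement hb hm
    (half_pos hR) (half_lt_self hR) (half_pos hρ) (half_lt_self hρ)] at h
  rw [degreeOneAt_iff hb' (half_pos hρ) (half_lt_self hρ),
    homotopicToInclusion_iff_displacement hb' hm'
    (half_pos hρ) (half_lt_self hρ) one_half_pos one_half_lt_one] at h'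
  rw [degreeOneAt_iff hs (half_pos hR) (half_lt_self hR),
    homotopicToInclusion_iff_displacement hs hms
    (half_pos hR) (half_lt_self hR) one_half_pos one_half_lt_one]
  have h1 := ((ContinuousMap.Homotopic.refl (displacement e' (e p) ρ 1 hb' hm')).comp h).trans h'
  convert h1 using 1
  ext1 v; ext1; simp [displacement]

theorem DegreeOneAt.symm {e : OpenPartialHomeomorph E3 E3} {p : E3} (hp : p ∈ e.source)
    (h : DegreeOneAt e p) : DegreeOneAt e.symm (e p) := by
  obtain ⟨R', hR', hb', hm'⟩ := exists_ball_mapsTo e.symm (e.map_source hp) one_pos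
  obtain ⟨R, hR, hb, hm⟩ := exists_ball_mapsTo e hp hR'
  obtain ⟨r, hr0, hr⟩ := exists_between (lt_min hR one_pos)
  have hr1 := hr.trans_le (min_le_left _ _)
  have hr2 := hr.trans_le (min_le_right _ _)
  rw [degreeOneAt_iff hb hr0 hr1, homotopicToInclusion_iff_displacement hb hm
    hr0 hr1 (half_pos hR') (half_lt_self hR')] at h
  rw [degreeOneAt_iff hb' (half_pos hR') (half_lt_self hR'),
    homotopicToInclusion_iff_displacement hb' hm'
    (half_pos hR') (half_lt_self hR') hr0 hr2]
  have h1 := (ContinuousMap.Homotopic.refl (displacement e.symm (e p) R' 1 hb' hm')).comp h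
  refine h1.symm.trans ?_
  rw [show (displacement e.symm (e p) R' 1 hb' hm').comp
    ((displacement e p R R' hb hm).comp (sphereIncl hr0 hr1)) = sphereIncl hr0 hr2 from ?_]
  ext1 v; ext1
  have : p + r • (v : E3) ∈ e.source := hb (by
    have h1 : ‖(v : E3)‖ = 1 := by simp
    simp [norm_smul, h1, abs_of_pos hr0, hr1])
  simp [displacement, sphereIncl, e.left_inv this, e.left_inv hp]

theorem DegreeOneAt.eventually_iff {e : OpenPartialHomeomorph E3 E3} {p : E3} (hp : p ∈ e.source) :
    ∀ᶠ q in 𝓝 p, DegreeOneAt e q ↔ DegreeOneAt e p := by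
  obtain ⟨R, hR, hb⟩ := Metric.mem_nhds_iff.1 (e.open_source.mem_nhds hp)
  have hR2 := half_pos hR
  have hR4 := half_pos hR2
  filter_upwards [Metric.ball_mem_nhds p hR2] with q hq
  have hbq : Metric.ball q (R / 2) ⊆ e.source :=
    (Metric.ball_subset_ball' (by have := Metric.mem_ball.1 hq; linarith)).trans hb
  rw [degreeOneAt_iff hbq hR4 (half_lt_self hR2), degreeOneAt_iff hb hR4 (by linarith)]
  have hsub : Metric.ball p (R / 2) ⊆ Metric.ball p R := Metric.ball_subset_ball (by linarith)
  -- the centre moves along the segment from `q` to `p`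
  have hc (t : unitInterval) : AffineMap.lineMap q p (t : ℝ) ∈ Metric.ball p (R / 2) :=
    (convex_ball p (R / 2)).lineMap_mem hq (Metric.mem_ball_self hR2) t.2
  have hcv (t : unitInterval) (v : S2) :
      AffineMap.lineMap q p (t : ℝ) + (R / 2 / 2) • (v : E3) ∈ Metric.ball p R := by
    have h1 : ‖(v : E3)‖ = 1 := by simp
    have h2 := Metric.mem_ball.1 (hc t)
    rw [Metric.mem_ball]
    refine (dist_triangle _ (AffineMap.lineMap q p (t : ℝ)) _).trans_lt ?_
    rw [dist_eq_norm, add_sub_cancel_left, norm_smul, h1, Real.norm_of_nonneg hR4.le]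
    linarith
  have hne (t : unitInterval) (v : S2) :
      e (AffineMap.lineMap q p (t : ℝ) + (R / 2 / 2) • (v : E3)) - e (AffineMap.lineMap q p (t : ℝ))
        ≠ 0 := by
    intro h
    have h2 := e.injOn (hb (hcv t v)) (hb (hsub (hc t))) (sub_eq_zero.1 h)
    have h1 : ‖(v : E3)‖ = 1 := by simp
    rw [add_eq_left] at h2
    have := congrArg norm h2
    rw [norm_smul, h1, Real.norm_of_nonneg hR4.le, norm_zero] at this
    linarith
  have hcont : Continuous fun z : unitInterval × S2 =>
      e (AffineMap.lineMap q p (z.1 : ℝ) + (R / 2 / 2) • (z.2 : E3))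
        - e (AffineMap.lineMap q p (z.1 : ℝ)) := by
    have hl : Continuous fun z : unitInterval × S2 => AffineMap.lineMap q p (z.1 : ℝ) :=
      AffineMap.lineMap_continuous.comp (by fun_prop)
    refine Continuous.sub (e.continuousOn.comp_continuous (by fun_prop) fun z => hb (hcv z.1 z.2))
      (e.continuousOn.comp_continuous hl fun z => hb (hsub (hc z.1)))
  let H : C(unitInterval × S2, PuncturedSpace) := ⟨fun z => ⟨_, hne z.1 z.2⟩, hcont.subtype_mk _⟩
  let g (t : unitInterval) : C(S2, PuncturedSpace) := ⟨fun v => H (t, v), by fun_prop⟩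
  have hg : (g 0).Homotopic (g 1) := ⟨⟨H, fun _ => rfl, fun _ => rfl⟩⟩
  have h0 := homotopicToInclusion_iff (g 0)
  have h1 := homotopicToInclusion_iff (g 1)
  rw [show (fun v => (g 0 v : E3)) = fun v : S2 => e (q + (R / 2 / 2) • (v : E3)) - e q by
    funext v; simp [g, H]] at h0
  rw [show (fun v => (g 1 v : E3)) = fun v : S2 => e (p + (R / 2 / 2) • (v : E3)) - e p by
    funext v; simp [g, H]] at h1
  rw [h0, h1]
  exact ⟨fun h => hg.symm.trans h, fun h => hg.trans h⟩

/-! ### Orientations and local homeomorphisms -/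

section

variable {X Y Z : Type*} [TopologicalSpace X] [TopologicalSpace Y] [TopologicalSpace Z]
  {oX : OrientedAtlas X} {oY : OrientedAtlas Y} {oZ : OrientedAtlas Z}

/-- The local homeomorphism `θ` between oriented 3-manifolds preserves the orientation at `x`. -/
def LocallyPreserves (oX : OrientedAtlas X) (oY : OrientedAtlas Y) (θ : OpenPartialHomeomorph X Y)
    (x : X) : Prop :=
  ∀ φ ∈ oX.charts, x ∈ φ.source → ∀ ψ ∈ oY.charts, θ x ∈ ψ.source →
    DegreeOneAt ((φ.symm.trans θ).trans ψ) (φ x)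

/-- By the chain rule for degrees, it suffices to test the orientation in one pair of charts. -/
theorem locallyPreserves_iff_charts {θ : OpenPartialHomeomorph X Y} {x : X} (hx : x ∈ θ.source)
    {φ : OpenPartialHomeomorph X E3} (hφ : φ ∈ oX.charts) (hxφ : x ∈ φ.source)
    {ψ : OpenPartialHomeomorph Y E3} (hψ : ψ ∈ oY.charts) (hxψ : θ x ∈ ψ.source) :
    LocallyPreserves oX oY θ x ↔ DegreeOneAt ((φ.symm.trans θ).trans ψ) (φ x) := by
  refine ⟨fun h => h φ hφ hxφ ψ hψ hxψ, fun h φ' hφ' hxφ' ψ' hψ' hxψ' => ?_⟩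
  have h1 : DegreeOneAt (φ'.symm.trans φ) (φ' x) := oX.compatible φ' hφ' φ hφ x ⟨hxφ', hxφ⟩
  have h2 : DegreeOneAt (ψ.symm.trans ψ') (ψ (θ x)) := oY.compatible ψ hψ ψ' hψ' _ ⟨hxψ, hxψ'⟩
  have e1 : (φ'.symm.trans φ) (φ' x) = φ x := by simp [hxφ']
  have e2 : ((φ'.symm.trans φ).trans ((φ.symm.trans θ).trans ψ)) (φ' x) = ψ (θ x) := by
    simp [hxφ, hxφ']
  have h3 : DegreeOneAt ((φ'.symm.trans φ).trans ((φ.symm.trans θ).trans ψ)) (φ' x) :=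
    DegreeOneAt.comp (by simp [hxφ, hxφ']) (by simp [hxφ, hxφ', hx, hxψ]) h1 (by rwa [e1])
  have h4 : DegreeOneAt (((φ'.symm.trans φ).trans ((φ.symm.trans θ).trans ψ)).trans
      (ψ.symm.trans ψ')) (φ' x) :=
    DegreeOneAt.comp (by simp [hxφ, hxφ', hx, hxψ]) (by rw [e2]; simp [hxψ, hxψ']) h3 (by rwa [e2])
  refine h4.congr ?_
  have c1 : Tendsto φ'.symm (𝓝 (φ' x)) (𝓝 x) := by
    simpa [ContinuousAt, hxφ'] using φ'.symm.continuousAt (φ'.map_source hxφ')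
  filter_upwards [c1 (φ.open_source.mem_nhds hxφ),
    c1 (θ.continuousAt hx (ψ.open_source.mem_nhds hxψ))] with p hp1 hp2
  simp only [mem_preimage] at hp1 hp2
  simp [hp1, hp2]

theorem locallyPreserves_congr {θ θ' : OpenPartialHomeomorph X Y} {x : X}
    (h : θ =ᶠ[𝓝 x] θ') : LocallyPreserves oX oY θ x ↔ LocallyPreserves oX oY θ' x := by
  refine forall₅_congr fun φ hφ hxφ ψ hψ => ?_
  rw [h.eq_of_nhds]
  refine imp_congr_right fun _ => degreeOneAt_congr ?_
  have c1 : Tendsto φ.symm (𝓝 (φ x)) (𝓝 x) := by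
    simpa [ContinuousAt, hxφ] using φ.symm.continuousAt (φ.map_source hxφ)
  filter_upwards [c1.eventually h] with p hp
  simp [hp]

theorem LocallyPreserves.trans {θ : OpenPartialHomeomorph X Y} {η : OpenPartialHomeomorph Y Z}
    {x : X} (hx : x ∈ θ.source) (hy : θ x ∈ η.source) (h : LocallyPreserves oX oY θ x)
    (h' : LocallyPreserves oY oZ η (θ x)) : LocallyPreserves oX oZ (θ.trans η) x := by
  obtain ⟨φ, hφ, hxφ⟩ := oX.cover x
  obtain ⟨ψ, hψ, hxψ⟩ := oY.cover (θ x)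
  obtain ⟨χ, hχ, hxχ⟩ := oZ.cover (η (θ x))
  rw [locallyPreserves_iff_charts (by simp [hx, hy]) hφ hxφ hχ (by simpa using hxχ)]
  have e1 : ((φ.symm.trans θ).trans ψ) (φ x) = ψ (θ x) := by simp [hxφ]
  have h3 := DegreeOneAt.comp (by simp [hxφ, hx, hxψ])
    (by rw [e1]; simp [hxψ, hy, hxχ]) (h φ hφ hxφ ψ hψ hxψ)
    (e1 ▸ h' ψ hψ hxψ χ hχ hxχ)
  refine h3.congr ?_
  have c1 : Tendsto φ.symm (𝓝 (φ x)) (𝓝 x) := by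
    simpa [ContinuousAt, hxφ] using φ.symm.continuousAt (φ.map_source hxφ)
  filter_upwards [c1 (θ.continuousAt hx (ψ.open_source.mem_nhds hxψ))] with p hp
  simp only [mem_preimage] at hp
  simp [hp]

theorem LocallyPreserves.symm {θ : OpenPartialHomeomorph X Y} {x : X} (hx : x ∈ θ.source)
    (h : LocallyPreserves oX oY θ x) : LocallyPreserves oY oX θ.symm (θ x) := by
  obtain ⟨φ, hφ, hxφ⟩ := oX.cover x
  obtain ⟨ψ, hψ, hxψ⟩ := oY.cover (θ x)
  rw [locallyPreserves_iff_charts (by simp [hx]) hψ hxψ hφ (by simpa [hx] using hxφ)]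
  have h1 := DegreeOneAt.symm (by simp [hxφ, hx, hxψ]) (h φ hφ hxφ ψ hψ hxψ)
  have e1 : ((φ.symm.trans θ).trans ψ) (φ x) = ψ (θ x) := by simp [hxφ]
  rw [e1] at h1
  exact h1

theorem locallyPreserves_refl (x : X) : LocallyPreserves oX oX (OpenPartialHomeomorph.refl X) x :=
  fun φ hφ hxφ ψ hψ hxψ => oX.compatible φ hφ ψ hψ x ⟨hxφ, hxψ⟩

/-- Whether a local homeomorphism preserves the orientation is locally constant. -/
theorem LocallyPreserves.eventually_iff {θ : OpenPartialHomeomorph X Y} {x : X}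
    (hx : x ∈ θ.source) :
    ∀ᶠ y in 𝓝 x, LocallyPreserves oX oY θ y ↔ LocallyPreserves oX oY θ x := by
  obtain ⟨φ, hφ, hxφ⟩ := oX.cover x
  obtain ⟨ψ, hψ, hxψ⟩ := oY.cover (θ x)
  rw [locallyPreserves_iff_charts hx hφ hxφ hψ hxψ]
  have h1 := DegreeOneAt.eventually_iff (e := (φ.symm.trans θ).trans ψ) (p := φ x)
    (by simp [hxφ, hx, hxψ])
  filter_upwards [(φ.continuousAt hxφ).eventually h1, θ.open_source.mem_nhds hx,
    φ.open_source.mem_nhds hxφ, θ.continuousAt hx (ψ.open_source.mem_nhds hxψ)] with y h2 h3 h4 h5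
  rw [locallyPreserves_iff_charts h3 hφ h4 hψ h5, h2]

/-- A homeomorphism that preserves the orientation at one point of a connected set does so at all
of its points. -/
theorem LocallyPreserves.of_isPreconnected {g : X ≃ₜ Y} {s : Set X} (hs : IsPreconnected s)
    {x y : X} (hx : x ∈ s) (hy : y ∈ s) (h : LocallyPreserves oX oY g.toOpenPartialHomeomorph x) :
    LocallyPreserves oX oY g.toOpenPartialHomeomorph y := by
  have hc : IsClopen {z | LocallyPreserves oX oY g.toOpenPartialHomeomorph z} := by
    constructor
    · rw [← isOpen_compl_iff, isOpen_iff_mem_nhds]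
      intro z hz
      filter_upwards [LocallyPreserves.eventually_iff (oX := oX) (oY := oY)
        (θ := g.toOpenPartialHomeomorph) (mem_univ z)] with w hw
      exact fun h' => hz (hw.1 h')
    · rw [isOpen_iff_mem_nhds]
      intro z hz
      filter_upwards [LocallyPreserves.eventually_iff (oX := oX) (oY := oY)
        (θ := g.toOpenPartialHomeomorph) (mem_univ z)] with w hw
      exact hw.2 hz
  exact hs.subset_isClopen hc ⟨x, hx, h⟩ hy

/-- For embeddings `i`, `j` of the same space, `LocallyPreserves` for a local homeomorphism that
agrees with `j ∘ i⁻¹` near `i u` expresses `PreservesOrientationAt`. -/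
theorem preservesOrientationAt_iff {U : Type*} {i : U → X} {j : U → Y} {u : U}
    (hi : Function.Injective i) (hr : range i ∈ 𝓝 (i u)) {θ : OpenPartialHomeomorph X Y}
    (hθ : ∀ᶠ x in 𝓝 (i u), ∀ w, i w = x → j w = θ x) :
    PreservesOrientationAt oX oY i j u ↔ LocallyPreserves oX oY θ (i u) := by
  have hu : j u = θ (i u) := hθ.self_of_nhds u rfl
  refine forall₅_congr fun φ hφ hxφ ψ hψ => ?_
  rw [hu]
  refine imp_congr_right fun _ => degreeOneAt_congr ?_
  have c1 : Tendsto φ.symm (𝓝 (φ (i u))) (𝓝 (i u)) := by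
    simpa [ContinuousAt, hxφ] using φ.symm.continuousAt (φ.map_source hxφ)
  filter_upwards [c1.eventually hθ, c1 hr] with p hp ⟨w, hw⟩
  rw [← hw, hi.extend_apply, hp w hw]
  simp

theorem orientationPreserving_iff (g : X ≃ₜ Y) : OrientationPreserving oX oY g ↔
    ∀ x, LocallyPreserves oX oY g.toOpenPartialHomeomorph x :=
  forall_congr' fun x => preservesOrientationAt_iff (i := id) (u := x) Function.injective_id
    (by simp) (Eventually.of_forall fun x w hw => by simp_all)

/-- The pull-back of an orientation along a homeomorphism. -/
def OrientedAtlas.pullback (oY : OrientedAtlas Y) (g : X ≃ₜ Y) : OrientedAtlas X where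
  charts := (fun φ => g.toOpenPartialHomeomorph.trans φ) '' oY.charts
  cover x := by
    obtain ⟨φ, hφ, hx⟩ := oY.cover (g x)
    exact ⟨_, ⟨φ, hφ, rfl⟩, by simpa using hx⟩
  compatible := by
    rintro _ ⟨φ, hφ, rfl⟩ _ ⟨ψ, hψ, rfl⟩ x hx
    simpa using oY.compatible φ hφ ψ hψ (g x) (by simpa using hx)

theorem OrientedAtlas.orientationPreserving_pullback (oY : OrientedAtlas Y) (g : X ≃ₜ Y) :
    OrientationPreserving (oY.pullback g) oY g := by
  rw [orientationPreserving_iff]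
  rintro x _ ⟨φ, hφ, rfl⟩ hx ψ hψ hx'
  simpa [Function.comp_def] using
    oY.compatible φ hφ ψ hψ (g x) ⟨by simpa using hx, by simpa using hx'⟩

theorem OrientedAtlas.preservesOrientationAt_pullback {U : Type*} {i : U → Z} {j : U → X} {u : U}
    (g : X ≃ₜ Y) : PreservesOrientationAt oZ (oY.pullback g) i j u ↔
      PreservesOrientationAt oZ oY i (fun w => g (j w)) u := by
  constructor
  · intro h φ hφ hφu ψ hψ hψu
    exact h φ hφ hφu _ ⟨ψ, hψ, rfl⟩ (by simpa using hψu)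
  · rintro h φ hφ hφu _ ⟨ψ, hψ, rfl⟩ hψu
    exact h φ hφ hφu ψ hψ (by simpa using hψu)

end

open TubularNbhd

/-! ### Extending torus homeomorphisms over the solid torus -/

/-- A homeomorphism of the torus `∂D² × S¹` extends to a homeomorphism of the solid torus `D² × S¹`
that preserves the core `0 × S¹`. -/
def ExtendsOver (φ : (Circle × Circle) ≃ₜ (Circle × Circle)) : Prop :=
  ∃ Φ : SolidTorus ≃ₜ SolidTorus, (∀ p, Φ (solidTorusBoundary p) = solidTorusBoundary (φ p)) ∧
    ∀ x, ((Φ x).1 : ℂ) = 0 ↔ (x.1 : ℂ) = 0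

theorem ExtendsOver.symm {φ : (Circle × Circle) ≃ₜ (Circle × Circle)} (h : ExtendsOver φ) :
    ExtendsOver φ.symm := by
  obtain ⟨Φ, h1, h2⟩ := h
  refine ⟨Φ.symm, fun p => ?_, fun x => ?_⟩
  · rw [Homeomorph.symm_apply_eq, h1, Homeomorph.apply_symm_apply]
  · rw [← h2, Homeomorph.apply_symm_apply]

theorem ExtendsOver.trans {φ ψ : (Circle × Circle) ≃ₜ (Circle × Circle)} (h : ExtendsOver φ)
    (h' : ExtendsOver ψ) : ExtendsOver (φ.trans ψ) := by
  obtain ⟨Φ, h1, h2⟩ := h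
  obtain ⟨Ψ, h3, h4⟩ := h'
  exact ⟨Φ.trans Ψ, fun p => by simp [h1, h3], fun x => by simp [h2, h4]⟩

theorem solidTorusBoundary_fst (p : Circle × Circle) : ((solidTorusBoundary p).1 : ℂ) = p.1 := rfl

theorem solidTorusBoundary_snd (p : Circle × Circle) : (solidTorusBoundary p).2 = p.2 := rfl

/-- On the compact solid torus a continuous bijection is a homeomorphism. -/
theorem ExtendsOver.of_map {φ : (Circle × Circle) ≃ₜ (Circle × Circle)}
    (F : SolidTorus → ℂ × Circle) (hF : Continuous F) (hn : ∀ x, ‖(F x).1‖ = ‖(x.1 : ℂ)‖)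
    (hi : Function.Injective F) (hs : ∀ (z : ℂ) (w : Circle), ‖z‖ ≤ 1 → ∃ x, F x = (z, w))
    (hb : ∀ p, F (solidTorusBoundary p) = (((φ p).1 : ℂ), (φ p).2)) : ExtendsOver φ := by
  let G : SolidTorus → SolidTorus := fun x => (⟨(F x).1, by
    simpa only [hn, mem_closedBall_zero_iff] using x.1.2⟩, (F x).2)
  have hG : Continuous G := by fun_prop
  have hGF (x y) : G x = y ↔ F x = (y.1.1, y.2) := by
    simp [G, Prod.ext_iff, Subtype.ext_iff]
  have hbij : Function.Bijective G := by
    refine ⟨fun x y h => hi ?_, fun y => ?_⟩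
    · rw [(hGF x _).1 h]
    · obtain ⟨x, hx⟩ := hs y.1 y.2 (mem_closedBall_zero_iff.1 y.1.2)
      exact ⟨x, (hGF x y).2 hx⟩
  refine ⟨Continuous.homeoOfEquivCompactToT2 (f := Equiv.ofBijective G hbij) hG, fun p => ?_,
    fun x => ?_⟩
  · exact (hGF _ _).2 (hb p)
  · change (F x).1 = 0 ↔ _
    rw [← norm_eq_zero, hn, norm_eq_zero]

/-- The direction of a complex number; the value at `0` is a dummy. -/
noncomputable def direction (z : ℂ) : Circle := Circle.exp z.arg

theorem norm_mul_direction (z : ℂ) : (‖z‖ : ℂ) * direction z = z := by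
  rw [direction, Circle.coe_exp, Complex.norm_mul_exp_arg_mul_I]

theorem direction_mul {r : ℝ} (hr : 0 < r) (u : Circle) : direction (r * u) = u := by
  rw [direction, Complex.arg_real_mul _ hr, Circle.exp_arg]

theorem direction_coe (u : Circle) : direction u = u := Circle.exp_arg u

theorem norm_ofReal_mul_circle {r : ℝ} (hr : 0 ≤ r) (u : Circle) : ‖(r : ℂ) * u‖ = r := by
  simp [abs_of_nonneg hr, Circle.norm_coe]

theorem isInducing_circle_coe : IsInducing (X := Circle) (fun u : Circle => (u : ℂ)) :=
  IsInducing.subtypeVal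

theorem continuousAt_direction {z : ℂ} (hz : z ≠ 0) : ContinuousAt direction z := by
  rw [isInducing_circle_coe.continuousAt_iff]
  have h : (fun u : Circle => (u : ℂ)) ∘ direction = fun z : ℂ =>
      if z = 0 then 1 else z / (‖z‖ : ℂ) := by
    funext z
    by_cases h : z = 0
    · simp [h, direction]
    · simp only [Function.comp, h, if_false]
      rw [eq_div_iff (by simpa using h), mul_comm, norm_mul_direction]
  rw [h]
  have h1 : ContinuousAt (fun z : ℂ => z / ‖z‖) z :=
    continuousAt_id.div (by fun_prop) (by simpa using hz)
  refine h1.congr ?_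
  filter_upwards [isOpen_ne.mem_nhds hz] with y hy
  exact (if_neg hy).symm

/-- A torus homeomorphism that is isotopic to one which permutes the level curves `∂D² × {w}`
extends over the solid torus: the isotopy runs along the concentric tori of radius between `1/2` and
`1`, and inside the discs `D² × {w}` are mapped by coning. -/
theorem ExtendsOver.of_isotopy (H : unitInterval → (Circle × Circle) ≃ₜ (Circle × Circle))
    (hH : Continuous fun p : unitInterval × (Circle × Circle) => H p.1 p.2) (β : Circle ≃ₜ Circle)
    (h0 : ∀ p, (H 0 p).2 = β p.2) : ExtendsOver (H 1) := by
  let τ : ℝ → unitInterval := fun r => projIcc 0 1 zero_le_one (2 * r - 1)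
  have hτ : Continuous τ := continuous_projIcc.comp (by fun_prop)
  have hτ0 {r : ℝ} (hr : r ≤ 1 / 2) : τ r = 0 := projIcc_of_le_left _ (by linarith)
  have hτ1 : τ 1 = 1 := projIcc_of_right_le _ (by norm_num)
  let P : ℂ × Circle → Circle × Circle := fun x => H (τ ‖x.1‖) (direction x.1, x.2)
  let F : ℂ × Circle → ℂ × Circle := fun x => ((‖x.1‖ : ℂ) * (P x).1, (P x).2)
  have hn (x : ℂ × Circle) : ‖(F x).1‖ = ‖x.1‖ := norm_ofReal_mul_circle (norm_nonneg _) _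
  have hF0 {x : ℂ × Circle} (hx : ‖x.1‖ ≤ 1 / 2) : (F x).2 = β x.2 := by simp [F, P, hτ0 hx, h0]
  have hF : Continuous F := by
    rw [continuous_iff_continuousAt]
    rintro ⟨z, w⟩
    by_cases hz : z = 0
    · subst hz
      have hev : ∀ᶠ x : ℂ × Circle in 𝓝 (0, w), ‖x.1‖ ≤ 1 / 2 := by
        have : ContinuousAt (fun x : ℂ × Circle => ‖x.1‖) (0, w) := by fun_prop
        exact this.eventually (Iic_mem_nhds (by simp))
      refine ContinuousAt.prodMk ?_ ?_
      · have : Tendsto (fun x : ℂ × Circle => ‖x.1‖) (𝓝 (0, w)) (𝓝 0) := by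
          have : ContinuousAt (fun x : ℂ × Circle => ‖x.1‖) (0, w) := by fun_prop
          simpa [ContinuousAt] using this
        rw [ContinuousAt, show (‖((0 : ℂ), w).1‖ : ℂ) * (P (0, w)).1 = 0 by simp]
        exact squeeze_zero_norm (fun x => (hn x).le) this
      · have : ContinuousAt (fun x : ℂ × Circle => β x.2) (0, w) := by fun_prop
        exact this.congr (hev.mono fun x hx => (hF0 hx).symm)
    · have hd : ContinuousAt (fun x : ℂ × Circle => direction x.1) (z, w) :=
        ContinuousAt.comp (x := (z, w)) (f := Prod.fst) (continuousAt_direction hz) continuousAt_fst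
      have hP : ContinuousAt P (z, w) := by
        have : ContinuousAt (fun x : ℂ × Circle => (τ ‖x.1‖, (direction x.1, x.2))) (z, w) := by
          refine ContinuousAt.prodMk ?_ (hd.prodMk continuousAt_snd)
          exact (hτ.comp (continuous_norm.comp continuous_fst)).continuousAt
        exact ContinuousAt.comp (f := fun x : ℂ × Circle => (τ ‖x.1‖, (direction x.1, x.2)))
          hH.continuousAt this
      refine ContinuousAt.prodMk (ContinuousAt.mul (by fun_prop) ?_) (continuousAt_snd.comp hP)
      exact (isInducing_circle_coe.continuous.comp continuous_fst).continuousAt.comp hP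
  refine ExtendsOver.of_map (fun x => F (x.1, x.2)) (hF.comp (by fun_prop)) (fun x => hn _) ?_ ?_ ?_
  · intro x y hxy
    have hnorm : ‖(x.1 : ℂ)‖ = ‖(y.1 : ℂ)‖ := by
      have h1 := hn (x.1, x.2)
      have h2 := hn (y.1, y.2)
      simp only at hxy h1 h2
      rw [← h1, ← h2, hxy]
    by_cases hx : (x.1 : ℂ) = 0
    · have hy : (y.1 : ℂ) = 0 := by rwa [hx, norm_zero, eq_comm, norm_eq_zero] at hnorm
      have h1 := congrArg Prod.snd hxy
      rw [hF0 (by simp [hx]), hF0 (by simp [hy])] at h1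
      exact Prod.ext (Subtype.ext (hx.trans hy.symm)) (β.injective h1)
    · have h1 := congrArg Prod.fst hxy
      have h2 := congrArg Prod.snd hxy
      simp only [F, P, hnorm] at h1 h2
      have hy : (‖(y.1 : ℂ)‖ : ℂ) ≠ 0 := by rw [← hnorm]; simpa using hx
      have h3 := (H (τ ‖(y.1 : ℂ)‖)).injective
        (Prod.ext (Circle.coe_injective (mul_left_cancel₀ hy h1)) h2)
      rw [Prod.ext_iff] at h3
      refine Prod.ext (Subtype.ext ?_) h3.2
      rw [← norm_mul_direction x.1, ← norm_mul_direction y.1, hnorm]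
      exact congrArg (fun u : Circle => (‖(y.1 : ℂ)‖ : ℂ) * u) h3.1
  · intro z w hz
    by_cases h : z = 0
    · refine ⟨(⟨0, by simp⟩, β.symm w), ?_⟩
      refine Prod.ext ?_ ?_
      · simp [F, h]
      · change (F (0, β.symm w)).2 = w
        rw [hF0 (by simp), Homeomorph.apply_symm_apply]
    · have hz0 : 0 < ‖z‖ := norm_pos_iff.2 h
      obtain ⟨p, hp⟩ := (H (τ ‖z‖)).surjective (direction z, w)
      refine ⟨(⟨(‖z‖ : ℂ) * p.1, by
        rwa [mem_closedBall_zero_iff, norm_ofReal_mul_circle hz0.le]⟩, p.2), ?_⟩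
      have h1 := norm_ofReal_mul_circle hz0.le p.1
      simp only [F, P, h1, direction_mul hz0, hp, norm_mul_direction]
  · intro p
    simp only [solidTorusBoundary_fst, solidTorusBoundary_snd, F, P, Circle.norm_coe, hτ1,
      direction_coe]
    simp

theorem ExtendsOver.prodCongr (α β : Circle ≃ₜ Circle) : ExtendsOver (α.prodCongr β) :=
  ExtendsOver.of_isotopy (fun _ => α.prodCongr β) ((α.prodCongr β).continuous.comp continuous_snd) β
    fun _ => rfl

/-! ### Cutting the solid torus open along a meridional disc -/

/-- The parametrization of the circle by `[-1, 1]` that sends both end points to `1`. -/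
noncomputable def cutParam (t : ℝ) : Circle := -Circle.exp (Real.pi * t)

/-- The inverse of `cutParam`, with values in `(-1, 1]`. -/
noncomputable def cutCoord (w : Circle) : ℝ := Complex.arg (-w : Circle) / Real.pi

@[fun_prop]
theorem continuous_cutParam : Continuous cutParam := by unfold cutParam; fun_prop

theorem circle_exp_pi : Circle.exp Real.pi = -1 := by
  ext; simp [Circle.coe_exp, Complex.exp_pi_mul_I]

@[simp]
theorem cutParam_one : cutParam 1 = 1 := by
  simp [cutParam, circle_exp_pi]

@[simp]
theorem cutParam_neg_one : cutParam (-1) = 1 := by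
  rw [cutParam, mul_neg, Circle.exp_neg, mul_one, circle_exp_pi]
  ext; simp

@[simp]
theorem cutParam_cutCoord (w : Circle) : cutParam (cutCoord w) = w := by
  rw [cutParam, cutCoord, mul_div_cancel₀ _ Real.pi_ne_zero, Circle.exp_arg, neg_neg]

theorem cutCoord_cutParam {t : ℝ} (h1 : -1 < t) (h2 : t ≤ 1) : cutCoord (cutParam t) = t := by
  have hp := Real.pi_pos
  rw [cutParam, cutCoord, neg_neg, Circle.arg_exp (by nlinarith) (by nlinarith),
    mul_div_cancel_left₀ _ hp.ne']

theorem cutCoord_mem (w : Circle) : cutCoord w ∈ Ioc (-1 : ℝ) 1 := by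
  have hp := Real.pi_pos
  rw [cutCoord, mem_Ioc, lt_div_iff₀ hp, div_le_iff₀ hp]
  exact ⟨by linarith [Complex.neg_pi_lt_arg (-w : Circle)],
    by linarith [Complex.arg_le_pi (-w : Circle)]⟩

theorem cutCoord_injective : Function.Injective cutCoord :=
  Function.LeftInverse.injective cutParam_cutCoord

@[simp]
theorem cutCoord_one : cutCoord 1 = 1 := by
  rw [← cutParam_one, cutCoord_cutParam (by norm_num) le_rfl]

theorem cutParam_injOn : InjOn cutParam (Ioc (-1) 1) := fun s hs t ht h => by
  rw [← cutCoord_cutParam hs.1 hs.2, h, cutCoord_cutParam ht.1 ht.2]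

theorem cutParam_ne_one {t : ℝ} (ht : |t| < 1) : cutParam t ≠ 1 := fun h => by
  rw [abs_lt] at ht
  have := cutCoord_cutParam ht.1 ht.2.le
  rw [h, cutCoord_one] at this
  linarith

theorem abs_cutCoord_lt_one {w : Circle} (hw : w ≠ 1) : |cutCoord w| < 1 := by
  have h := cutCoord_mem w
  refine abs_lt.2 ⟨h.1, lt_of_le_of_ne h.2 fun h1 => hw ?_⟩
  rw [← cutParam_cutCoord w, h1, cutParam_one]

theorem cutCoord_inv {w : Circle} (hw : w ≠ 1) : cutCoord w⁻¹ = -cutCoord w := by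
  have h := abs_lt.1 (abs_cutCoord_lt_one hw)
  have h2 : cutParam (-cutCoord w) = w⁻¹ := by
    conv_rhs => rw [← cutParam_cutCoord w]
    rw [cutParam, cutParam, mul_neg, Circle.exp_neg, inv_neg]
  rw [← h2, cutCoord_cutParam (by linarith) (by linarith)]

theorem continuousAt_cutCoord {w : Circle} (hw : w ≠ 1) : ContinuousAt cutCoord w := by
  have h : ((-w : Circle) : ℂ) ∈ Complex.slitPlane := by
    rw [Complex.mem_slitPlane_iff_arg]
    refine ⟨fun h => hw ?_, Circle.coe_ne_zero _⟩
    apply cutCoord_injective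
    rw [cutCoord_one, cutCoord, h, div_self Real.pi_ne_zero]
  refine ContinuousAt.div_const ?_ _
  exact ContinuousAt.comp (f := fun w : Circle => ((-w : Circle) : ℂ))
    (Complex.continuousAt_arg h) (by fun_prop)

/-- Although `cutCoord` jumps at `1`, its absolute value is continuous. -/
theorem continuous_abs_cutCoord : Continuous fun w => |cutCoord w| := by
  have h (w : Circle) :
      |cutCoord w| = InnerProductGeometry.angle 1 ((-w : Circle) : ℂ) / Real.pi := by
    rw [Complex.angle_one_left (Circle.coe_ne_zero _), cutCoord, abs_div, abs_of_pos Real.pi_pos]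
  simp_rw [h]
  refine Continuous.div_const ?_ _
  rw [continuous_iff_continuousAt]
  intro w
  exact ContinuousAt.comp (g := fun p : ℂ × ℂ => InnerProductGeometry.angle p.1 p.2)
    (f := fun w : Circle => ((1 : ℂ), ((-w : Circle) : ℂ)))
    (InnerProductGeometry.continuousAt_angle (by simp) (Circle.coe_ne_zero _)) (by fun_prop)

/-! ### The Alexander trick in the cut-open solid torus -/

section

variable {ψ : Circle × ℝ → Circle × ℝ}

/-- The extension over the cylinder `ℂ × ℝ`, homogeneous under dilations, of a self-map `ψ` of the
cylindrical surface `S¹ × ℝ`.  It is the identity on the axis. -/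
noncomputable def alexanderExtension (ψ : Circle × ℝ → Circle × ℝ) (x : ℂ × ℝ) : ℂ × ℝ :=
  ((‖x.1‖ : ℂ) * (ψ (direction x.1, x.2 / ‖x.1‖)).1,
    if x.1 = 0 then x.2 else ‖x.1‖ * (ψ (direction x.1, x.2 / ‖x.1‖)).2)

theorem norm_alexanderExtension_fst (x : ℂ × ℝ) : ‖(alexanderExtension ψ x).1‖ = ‖x.1‖ :=
  norm_ofReal_mul_circle (norm_nonneg _) _

theorem alexanderExtension_zero (t : ℝ) : alexanderExtension ψ (0, t) = (0, t) := by
  simp [alexanderExtension]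

theorem alexanderExtension_of_ne {z : ℂ} (hz : z ≠ 0) (t : ℝ) : alexanderExtension ψ (z, t) =
    ((‖z‖ : ℂ) * (ψ (direction z, t / ‖z‖)).1, ‖z‖ * (ψ (direction z, t / ‖z‖)).2) := by
  simp [alexanderExtension, hz]

theorem alexanderExtension_eq_self (hout : ∀ u t, 1 ≤ |t| → ψ (u, t) = (u, t)) {z : ℂ} {t : ℝ}
    (h : ‖z‖ ≤ |t|) : alexanderExtension ψ (z, t) = (z, t) := by
  by_cases hz : z = 0
  · rw [hz, alexanderExtension_zero]
  · have hz0 : 0 < ‖z‖ := norm_pos_iff.2 hz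
    rw [alexanderExtension_of_ne hz, hout _ _ (by rwa [abs_div, abs_norm, one_le_div hz0])]
    simp only [norm_mul_direction]
    rw [mul_div_cancel₀ _ hz0.ne']

theorem abs_alexanderExtension_snd_lt (hin : ∀ u t, |t| < 1 → |(ψ (u, t)).2| < 1) {z : ℂ} {t : ℝ}
    (h : |t| < ‖z‖) : |(alexanderExtension ψ (z, t)).2| < ‖z‖ := by
  have hz0 : 0 < ‖z‖ := (abs_nonneg _).trans_lt h
  rw [alexanderExtension_of_ne (norm_pos_iff.1 hz0)]
  have := hin (direction z) (t / ‖z‖) (by rwa [abs_div, abs_norm, div_lt_one hz0])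
  simp only [abs_mul, abs_norm]
  nlinarith

theorem alexanderExtension_injective (hinj : Function.Injective ψ) :
    Function.Injective (alexanderExtension ψ) := by
  rintro ⟨z, t⟩ ⟨z', t'⟩ h
  have hn : ‖z‖ = ‖z'‖ := by
    rw [← norm_alexanderExtension_fst (ψ := ψ) (z, t), h, norm_alexanderExtension_fst]
  by_cases hz : z = 0
  · have hz' : z' = 0 := by rwa [hz, norm_zero, eq_comm, norm_eq_zero] at hn
    subst hz hz'
    rwa [alexanderExtension_zero, alexanderExtension_zero] at h
  · have hz' : z' ≠ 0 := norm_pos_iff.1 (hn ▸ norm_pos_iff.2 hz)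
    have hr : ‖z'‖ ≠ 0 := norm_ne_zero_iff.2 hz'
    rw [alexanderExtension_of_ne hz, alexanderExtension_of_ne hz', hn, Prod.mk.injEq] at h
    have h1 := hinj (Prod.ext (Circle.coe_injective (mul_left_cancel₀ (by simpa using hr) h.1))
      (mul_left_cancel₀ hr h.2))
    rw [Prod.mk.injEq] at h1
    refine Prod.ext ?_ ?_
    · change z = z'
      rw [← norm_mul_direction z, ← norm_mul_direction z', hn]
      exact congrArg (fun u : Circle => (‖z'‖ : ℂ) * u) h1.1
    · simpa [div_left_inj' hr] using h1.2

theorem alexanderExtension_surjective (hsurj : Function.Surjective ψ) :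
    Function.Surjective (alexanderExtension ψ) := by
  rintro ⟨z, t⟩
  by_cases hz : z = 0
  · exact ⟨(0, t), by rw [hz, alexanderExtension_zero]⟩
  · have hz0 : 0 < ‖z‖ := norm_pos_iff.2 hz
    obtain ⟨⟨u, s⟩, hu⟩ := hsurj (direction z, t / ‖z‖)
    have h1 := norm_ofReal_mul_circle hz0.le u
    refine ⟨((‖z‖ : ℂ) * u, ‖z‖ * s), ?_⟩
    rw [alexanderExtension_of_ne (by rw [← norm_pos_iff, h1]; exact hz0), h1, direction_mul hz0,
      mul_div_cancel_left₀ _ hz0.ne', hu]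
    simp only [norm_mul_direction]
    rw [mul_div_cancel₀ _ hz0.ne']

theorem continuous_alexanderExtension (hψ : Continuous ψ)
    (hout : ∀ u t, 1 ≤ |t| → ψ (u, t) = (u, t)) (hin : ∀ u t, |t| < 1 → |(ψ (u, t)).2| < 1) :
    Continuous (alexanderExtension ψ) := by
  rw [continuous_iff_continuousAt]
  rintro ⟨z, t⟩
  by_cases hz : z = 0
  · subst hz
    have hN : Tendsto (fun x : ℂ × ℝ => ‖x.1‖) (𝓝 (0, t)) (𝓝 0) := by
      have : ContinuousAt (fun x : ℂ × ℝ => ‖x.1‖) (0, t) := by fun_prop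
      simpa [ContinuousAt] using this
    -- heights change by at most twice the radius
    have hb (x : ℂ × ℝ) : ‖(alexanderExtension ψ x).2 - x.2‖ ≤ 2 * ‖x.1‖ := by
      obtain ⟨y, s⟩ := x
      rcases le_or_gt ‖y‖ |s| with h | h
      · rw [alexanderExtension_eq_self hout h, sub_self, norm_zero]; positivity
      · have := abs_alexanderExtension_snd_lt hin h
        refine (norm_sub_le _ _).trans ?_
        simp only [Real.norm_eq_abs]
        linarith
    rw [ContinuousAt, alexanderExtension_zero]
    refine Tendsto.prodMk_nhds
      (squeeze_zero_norm (fun x => (norm_alexanderExtension_fst x).le) hN) ?_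
    have h1 : Tendsto (fun x => (alexanderExtension ψ x).2 - x.2) (𝓝 ((0 : ℂ), t)) (𝓝 0) :=
      squeeze_zero_norm hb (by simpa using hN.const_mul 2)
    have h2 := h1.add (continuousAt_snd (p := ((0 : ℂ), t)))
    simp only [sub_add_cancel, zero_add] at h2
    exact h2
  · have hd : ContinuousAt (fun x : ℂ × ℝ => direction x.1) (z, t) :=
      ContinuousAt.comp (x := (z, t)) (f := Prod.fst) (continuousAt_direction hz) continuousAt_fst
    have hN : ContinuousAt (fun x : ℂ × ℝ => ‖x.1‖) (z, t) := by fun_prop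
    have hP : ContinuousAt (fun x : ℂ × ℝ => ψ (direction x.1, x.2 / ‖x.1‖)) (z, t) :=
      ContinuousAt.comp (f := fun x : ℂ × ℝ => (direction x.1, x.2 / ‖x.1‖)) hψ.continuousAt
        (hd.prodMk (continuousAt_snd.div hN (norm_ne_zero_iff.2 hz)))
    refine ContinuousAt.prodMk (ContinuousAt.mul (by fun_prop) ?_) ?_
    · exact (isInducing_circle_coe.continuous.comp continuous_fst).continuousAt.comp hP
    · have : ContinuousAt (fun x : ℂ × ℝ => ‖x.1‖ * (ψ (direction x.1, x.2 / ‖x.1‖)).2) (z, t) :=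
        hN.mul (continuousAt_snd.comp hP)
      refine this.congr ?_
      filter_upwards [(isOpen_ne.preimage continuous_fst).mem_nhds hz] with x hx
      exact (if_neg hx).symm

/-- The Alexander trick: a torus homeomorphism that is obtained from a homeomorphism of
`S¹ × [-1, 1]` fixing both boundary circles pointwise extends over the solid torus. -/
theorem ExtendsOver.of_cut {φ : (Circle × Circle) ≃ₜ (Circle × Circle)} (hψ : Continuous ψ)
    (hbij : Function.Bijective ψ) (hout : ∀ u t, 1 ≤ |t| → ψ (u, t) = (u, t))
    (hin : ∀ u t, |t| < 1 → |(ψ (u, t)).2| < 1)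
    (hφ : ∀ u t, |t| ≤ 1 → φ (u, cutParam t) = ((ψ (u, t)).1, cutParam (ψ (u, t)).2)) :
    ExtendsOver φ := by
  let F : SolidTorus → ℂ × Circle := fun x =>
    ((alexanderExtension ψ (x.1, cutCoord x.2)).1,
      cutParam (alexanderExtension ψ (x.1, cutCoord x.2)).2)
  have hmem {z : ℂ} {t : ℝ} (hz : ‖z‖ ≤ 1) (ht : t ∈ Ioc (-1 : ℝ) 1) :
      (alexanderExtension ψ (z, t)).2 ∈ Ioc (-1 : ℝ) 1 := by
    rcases le_or_gt ‖z‖ |t| with h | h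
    · rwa [alexanderExtension_eq_self hout h]
    · have := abs_lt.1 ((abs_alexanderExtension_snd_lt hin h).trans_le hz)
      exact ⟨this.1, this.2.le⟩
  refine ExtendsOver.of_map F ?_ (fun x => norm_alexanderExtension_fst _) ?_ ?_ ?_
  · -- continuity is tested after cutting the solid torus open
    let q : Metric.closedBall (0 : ℂ) 1 × Icc (-1 : ℝ) 1 → SolidTorus := fun x =>
      (x.1, cutParam x.2)
    have hqc : Continuous q := by fun_prop
    have hq : IsQuotientMap q := by
      refine hqc.isClosedMap.isQuotientMap hqc fun x => ?_
      have h := cutCoord_mem x.2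
      exact ⟨(x.1, ⟨cutCoord x.2, h.1.le, h.2⟩), by simp [q]⟩
    rw [hq.continuous_iff]
    have h : F ∘ q = fun x => ((alexanderExtension ψ (x.1, x.2)).1,
        cutParam (alexanderExtension ψ (x.1, x.2)).2) := by
      funext ⟨z, t, ht⟩
      rcases eq_or_lt_of_le ht.1 with h | h
      · have hz : ‖(z : ℂ)‖ ≤ 1 := mem_closedBall_zero_iff.1 z.2
        subst h
        simp [F, q, alexanderExtension_eq_self hout (z := z) (t := 1) (by simpa using hz),
          alexanderExtension_eq_self hout (z := z) (t := -1) (by simpa using hz)]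
      · simp [F, q, cutCoord_cutParam h ht.2]
    rw [h]
    have hc : Continuous fun x : Metric.closedBall (0 : ℂ) 1 × Icc (-1 : ℝ) 1 =>
        alexanderExtension ψ (x.1, x.2) :=
      (continuous_alexanderExtension hψ hout hin).comp (by fun_prop)
    exact hc.fst.prodMk (continuous_cutParam.comp hc.snd)
  · intro x y h
    have hx : ‖(x.1 : ℂ)‖ ≤ 1 := mem_closedBall_zero_iff.1 x.1.2
    have hy : ‖(y.1 : ℂ)‖ ≤ 1 := mem_closedBall_zero_iff.1 y.1.2
    have h1 := congrArg Prod.fst h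
    have h2 := cutParam_injOn (hmem hx (cutCoord_mem _)) (hmem hy (cutCoord_mem _))
      (congrArg Prod.snd h)
    have h3 := alexanderExtension_injective hbij.1 (Prod.ext h1 h2)
    rw [Prod.mk.injEq] at h3
    exact Prod.ext (Subtype.ext h3.1) (cutCoord_injective h3.2)
  · intro z w hz
    obtain ⟨⟨z', t⟩, h⟩ := alexanderExtension_surjective hbij.2 (z, cutCoord w)
    have hn : ‖z'‖ = ‖z‖ := by
      rw [← norm_alexanderExtension_fst (ψ := ψ) (z', t), h]
    have ht : t ∈ Ioc (-1 : ℝ) 1 := by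
      rcases le_or_gt ‖z'‖ |t| with h' | h'
      · rw [alexanderExtension_eq_self hout h', Prod.mk.injEq] at h
        rw [h.2]; exact cutCoord_mem w
      · have := abs_lt.1 (h'.trans_le (hn.trans_le hz))
        exact ⟨this.1, this.2.le⟩
    refine ⟨(⟨z', by simpa [hn] using hz⟩, cutParam t), ?_⟩
    simp [F, cutCoord_cutParam ht.1 ht.2, h]
  · intro p
    have h1 := cutCoord_mem p.2
    have h2 := hφ p.1 (cutCoord p.2) (abs_le.2 ⟨h1.1.le, h1.2⟩)
    rw [cutParam_cutCoord, Prod.mk.eta] at h2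
    simp only [F, solidTorusBoundary_fst, solidTorusBoundary_snd]
    rw [alexanderExtension_of_ne (Circle.coe_ne_zero _), Circle.norm_coe, direction_coe, h2]
    simp

end

/-! ### Torus homeomorphisms that fix the meridian -/

section

variable {φ : (Circle × Circle) ≃ₜ (Circle × Circle)}

/-- The height, in the torus cut open along the meridian, of the image under `φ` of the point
`(u, t)` of the cut-open torus. -/
noncomputable def cutHeight (φ : (Circle × Circle) ≃ₜ (Circle × Circle)) (x : Circle × ℝ) : ℝ :=
  cutCoord (φ (x.1, cutParam x.2)).2

theorem snd_ne_one (hφ : ∀ u, φ (u, 1) = (u, 1)) {u w : Circle} (hw : w ≠ 1) :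
    (φ (u, w)).2 ≠ 1 := fun h => hw (by
  have h1 : φ (u, w) = φ ((φ (u, w)).1, 1) := by rw [hφ, ← h]
  exact congrArg Prod.snd (φ.injective h1))

theorem continuousAt_cutHeight (hφ : ∀ u, φ (u, 1) = (u, 1)) {x : Circle × ℝ} (hx : |x.2| < 1) :
    ContinuousAt (cutHeight φ) x :=
  ContinuousAt.comp (f := fun x : Circle × ℝ => (φ (x.1, cutParam x.2)).2)
    (continuousAt_cutCoord (snd_ne_one hφ (cutParam_ne_one hx))) (by fun_prop)

theorem continuous_abs_cutHeight (φ : (Circle × Circle) ≃ₜ (Circle × Circle)) :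
    Continuous fun x => |cutHeight φ x| :=
  continuous_abs_cutCoord.comp (f := fun x : Circle × ℝ => (φ (x.1, cutParam x.2)).2) (by fun_prop)

theorem cutHeight_of_cutParam_eq_one (hφ : ∀ u, φ (u, 1) = (u, 1)) {u : Circle} {t : ℝ}
    (ht : cutParam t = 1) : cutHeight φ (u, t) = 1 := by
  simp [cutHeight, ht, hφ]

theorem eventually_cutHeight_ne_zero (hφ : ∀ u, φ (u, 1) = (u, 1)) {t₀ : ℝ}
    (ht : cutParam t₀ = 1) : ∀ᶠ t in 𝓝 t₀, ∀ u, cutHeight φ (u, t) ≠ 0 := by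
  have h := isCompact_univ.eventually_forall_of_forall_eventually (x₀ := t₀)
    (K := (univ : Set Circle)) (P := fun t u => 0 < |cutHeight φ (u, t)|) fun u _ => by
      have hc : ContinuousAt (fun z : ℝ × Circle => |cutHeight φ (z.2, z.1)|) (t₀, u) :=
        ((continuous_abs_cutHeight φ).comp (by fun_prop : Continuous
          fun z : ℝ × Circle => (z.2, z.1))).continuousAt
      exact hc.eventually (lt_mem_nhds (by simp [cutHeight_of_cutParam_eq_one hφ ht]))
  filter_upwards [h] with t ht u
  exact abs_pos.1 (ht u (mem_univ u))

/-- The height does not change sign on an open annulus where it does not vanish. -/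
theorem cutHeight_sign (hφ : ∀ u, φ (u, 1) = (u, 1)) {a b : ℝ} (ha : -1 ≤ a) (hb : b ≤ 1)
    (h : ∀ t ∈ Ioo a b, ∀ u, cutHeight φ (u, t) ≠ 0) :
    (∀ t ∈ Ioo a b, ∀ u, 0 < cutHeight φ (u, t)) ∨ ∀ t ∈ Ioo a b, ∀ u, cutHeight φ (u, t) < 0 := by
  have hS : IsPreconnected ((univ : Set Circle) ×ˢ Ioo a b) :=
    isPreconnected_univ.prod isPreconnected_Ioo
  have hc : ContinuousOn (cutHeight φ) (univ ×ˢ Ioo a b) := fun x hx =>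
    (continuousAt_cutHeight hφ
      (abs_lt.2 ⟨ha.trans_lt hx.2.1, hx.2.2.trans_le hb⟩)).continuousWithinAt
  by_contra! hcon
  obtain ⟨⟨t, ht, u, h1⟩, ⟨s, hs, v, h2⟩⟩ := hcon
  obtain ⟨⟨w, r⟩, hr, h3⟩ := hS.intermediate_value (mk_mem_prod (mem_univ u) ht)
    (mk_mem_prod (mem_univ v) hs) hc ⟨h1, h2⟩
  exact h r hr.2 w h3

theorem cutHeight_sign_left (hφ : ∀ u, φ (u, 1) = (u, 1)) :
    (∀ᶠ t in 𝓝[>] (-1), ∀ u, 0 < cutHeight φ (u, t)) ∨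
      ∀ᶠ t in 𝓝[>] (-1), ∀ u, cutHeight φ (u, t) < 0 := by
  obtain ⟨r, hr, h⟩ := mem_nhdsGT_iff_exists_Ioo_subset.1 (mem_nhdsWithin_of_mem_nhds
    (eventually_cutHeight_ne_zero hφ cutParam_neg_one))
  have hr' : -1 < min r 1 := lt_min hr (by norm_num)
  refine (cutHeight_sign hφ le_rfl (min_le_right r 1) fun t ht => h ⟨ht.1, ht.2.trans_le
    (min_le_left _ _)⟩).imp ?_ ?_ <;>
  exact fun h1 => mem_of_superset (Ioo_mem_nhdsGT hr') h1

theorem cutHeight_sign_right (hφ : ∀ u, φ (u, 1) = (u, 1)) :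
    (∀ᶠ t in 𝓝[<] 1, ∀ u, 0 < cutHeight φ (u, t)) ∨
      ∀ᶠ t in 𝓝[<] 1, ∀ u, cutHeight φ (u, t) < 0 := by
  obtain ⟨l, hl, h⟩ := mem_nhdsLT_iff_exists_Ioo_subset.1 (mem_nhdsWithin_of_mem_nhds
    (eventually_cutHeight_ne_zero hφ cutParam_one))
  have hl' : max l (-1) < 1 := max_lt hl (by norm_num)
  refine (cutHeight_sign hφ (le_max_right l (-1)) le_rfl fun t ht => h ⟨(le_max_left _ _).trans_lt
    ht.1, ht.2⟩).imp ?_ ?_ <;>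
  exact fun h1 => mem_of_superset (Ioo_mem_nhdsLT hl') h1

/-- The two ends of the cut-open torus are not both mapped to the upper end, because `φ` is
surjective: otherwise the height would be bounded away from `-1`. -/
theorem not_cutHeight_pos_pos (hφ : ∀ u, φ (u, 1) = (u, 1))
    (h1 : ∀ᶠ t in 𝓝[>] (-1), ∀ u, 0 < cutHeight φ (u, t))
    (h2 : ∀ᶠ t in 𝓝[<] 1, ∀ u, 0 < cutHeight φ (u, t)) : False := by
  obtain ⟨r, hr, hr'⟩ := mem_nhdsGT_iff_exists_Ioo_subset.1 h1
  obtain ⟨l, hl, hl'⟩ := mem_nhdsLT_iff_exists_Ioo_subset.1 h2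
  rw [mem_Ioi] at hr
  rw [mem_Iio] at hl
  have hK : IsCompact ((univ : Set Circle) ×ˢ Icc r l) := isCompact_univ.prod isCompact_Icc
  have hlt {x : Circle × ℝ} (hx : x ∈ (univ : Set Circle) ×ˢ Icc r l) : |x.2| < 1 :=
    abs_lt.2 ⟨hr.trans_le hx.2.1, hx.2.2.trans_lt hl⟩
  obtain ⟨m, hm, hmK⟩ : ∃ m > -1, ∀ x ∈ (univ : Set Circle) ×ˢ Icc r l, m ≤ cutHeight φ x := by
    rcases ((univ : Set Circle) ×ˢ Icc r l).eq_empty_or_nonempty with he | hne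
    · exact ⟨0, by norm_num, by simp [he]⟩
    · obtain ⟨x, hx, hmin⟩ := hK.exists_isMinOn hne fun x hx =>
        (continuousAt_cutHeight hφ (hlt hx)).continuousWithinAt
      exact ⟨_, (cutCoord_mem _).1, hmin⟩
  obtain ⟨c, hc1, hc2⟩ := exists_between (lt_min hm (by norm_num : (-1 : ℝ) < 0))
  have hcm := hc2.trans_le (min_le_left _ _)
  have hc0 := hc2.trans_le (min_le_right _ _)
  obtain ⟨⟨u, w⟩, huw⟩ := φ.surjective (1, cutParam c)
  have hw : w ≠ 1 := by
    rintro rfl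
    rw [hφ] at huw
    exact cutParam_ne_one (abs_lt.2 ⟨hc1, by linarith⟩) (congrArg Prod.snd huw).symm
  have hval : cutHeight φ (u, cutCoord w) = c := by
    simp only [cutHeight, cutParam_cutCoord, huw]
    exact cutCoord_cutParam hc1 (by linarith)
  have ht := abs_lt.1 (abs_cutCoord_lt_one hw)
  rcases lt_or_ge (cutCoord w) r with h3 | h3
  · have : 0 < cutHeight φ (u, cutCoord w) := hr' ⟨ht.1, h3⟩ u
    linarith
  rcases lt_or_ge l (cutCoord w) with h4 | h4
  · have : 0 < cutHeight φ (u, cutCoord w) := hl' ⟨h4, ht.2⟩ u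
    linarith
  have := hmK (u, cutCoord w) ⟨mem_univ _, h3, h4⟩
  linarith

/-- The map of the surface `S¹ × ℝ` that `φ` induces on the cut-open torus `S¹ × [-1, 1]`, extended
by the identity. -/
noncomputable def cutMap (φ : (Circle × Circle) ≃ₜ (Circle × Circle)) (x : Circle × ℝ) :
    Circle × ℝ :=
  ((φ (x.1, cutParam (max (-1) (min 1 x.2)))).1, if |x.2| < 1 then cutHeight φ x else x.2)

theorem cutMap_of_abs_lt {u : Circle} {t : ℝ} (ht : |t| < 1) :
    cutMap φ (u, t) = ((φ (u, cutParam t)).1, cutHeight φ (u, t)) := by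
  obtain ⟨h1, h2⟩ := abs_lt.1 ht
  simp [cutMap, ht, min_eq_right h2.le, max_eq_right h1.le]

theorem cutMap_of_one_le_abs (hφ : ∀ u, φ (u, 1) = (u, 1)) {u : Circle} {t : ℝ} (ht : 1 ≤ |t|) :
    cutMap φ (u, t) = (u, t) := by
  have : cutParam (max (-1) (min 1 t)) = 1 := by
    rcases le_abs'.1 ht with h | h
    · rw [max_eq_left ((min_le_right _ _).trans h), cutParam_neg_one]
    · rw [min_eq_left h, max_eq_right (by norm_num), cutParam_one]
  simp [cutMap, not_lt.2 ht, this, hφ]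

theorem abs_cutHeight_lt_one (hφ : ∀ u, φ (u, 1) = (u, 1)) {u : Circle} {t : ℝ} (ht : |t| < 1) :
    |cutHeight φ (u, t)| < 1 :=
  abs_cutCoord_lt_one (snd_ne_one hφ (cutParam_ne_one ht))

theorem cutMap_bijective (hφ : ∀ u, φ (u, 1) = (u, 1)) : Function.Bijective (cutMap φ) := by
  have hin {u : Circle} {t : ℝ} (ht : |t| < 1) : |(cutMap φ (u, t)).2| < 1 := by
    rw [cutMap_of_abs_lt ht]; exact abs_cutHeight_lt_one hφ ht
  constructor
  · rintro ⟨u, t⟩ ⟨v, s⟩ h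
    rcases lt_or_ge |t| 1 with ht | ht <;> rcases lt_or_ge |s| 1 with hs | hs
    · rw [cutMap_of_abs_lt ht, cutMap_of_abs_lt hs, Prod.mk.injEq] at h
      have h1 := φ.injective (Prod.ext h.1 (cutCoord_injective h.2))
      rw [Prod.mk.injEq] at h1
      rw [abs_lt] at ht hs
      exact Prod.ext h1.1 (cutParam_injOn ⟨ht.1, ht.2.le⟩ ⟨hs.1, hs.2.le⟩ h1.2)
    · have := hin (u := u) ht
      rw [h, cutMap_of_one_le_abs hφ hs] at this
      exact absurd this (not_lt.2 hs)
    · have := hin (u := v) hs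
      rw [← h, cutMap_of_one_le_abs hφ ht] at this
      exact absurd this (not_lt.2 ht)
    · rwa [cutMap_of_one_le_abs hφ ht, cutMap_of_one_le_abs hφ hs] at h
  · rintro ⟨u, t⟩
    rcases lt_or_ge |t| 1 with ht | ht
    · obtain ⟨⟨v, w⟩, h⟩ := φ.surjective (u, cutParam t)
      have hw : w ≠ 1 := by
        rintro rfl
        rw [hφ] at h
        exact cutParam_ne_one ht (congrArg Prod.snd h).symm
      refine ⟨(v, cutCoord w), ?_⟩
      rw [abs_lt] at ht
      rw [cutMap_of_abs_lt (abs_cutCoord_lt_one hw), cutHeight, cutParam_cutCoord, h]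
      simp only [cutCoord_cutParam ht.1 ht.2.le]
    · exact ⟨(u, t), cutMap_of_one_le_abs hφ ht⟩

theorem continuous_cutMap (hφ : ∀ u, φ (u, 1) = (u, 1))
    (h1 : ∀ᶠ t in 𝓝[>] (-1), ∀ u, cutHeight φ (u, t) < 0)
    (h2 : ∀ᶠ t in 𝓝[<] 1, ∀ u, 0 < cutHeight φ (u, t)) : Continuous (cutMap φ) := by
  have habs := continuous_abs_cutHeight φ
  refine Continuous.prodMk (by fun_prop) ?_
  rw [continuous_iff_continuousAt]
  rintro ⟨u, t⟩
  have hsnd : ContinuousAt (Prod.snd : Circle × ℝ → ℝ) (u, t) := continuousAt_snd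
  rcases lt_trichotomy |t| 1 with ht | ht | ht
  · refine (continuousAt_cutHeight hφ ht).congr ?_
    filter_upwards [(hsnd.abs).eventually (gt_mem_nhds ht)] with x hx
    exact (if_pos hx).symm
  · -- at the ends the height equals plus or minus its absolute value
    rcases eq_or_eq_neg_of_abs_eq ht with rfl | rfl
    · have hc : Continuous fun x : Circle × ℝ => if x.2 ≤ 1 then |cutHeight φ x| else x.2 :=
        Continuous.if_le habs continuous_snd continuous_snd continuous_const fun x hx => by
          rw [show x = (x.1, 1) from Prod.ext rfl hx, cutHeight_of_cutParam_eq_one hφ cutParam_one]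
          simp
      refine hc.continuousAt.congr ?_
      filter_upwards [hsnd.eventually (eventually_nhdsWithin_iff.1 h2),
        hsnd.eventually (lt_mem_nhds (by norm_num : (-1 : ℝ) < 1))] with x hx hx'
      rcases lt_trichotomy x.2 1 with h | h | h
      · rw [if_pos h.le, if_pos (abs_lt.2 ⟨hx', h⟩)]
        exact abs_of_pos (hx h x.1)
      · rw [if_pos h.le, if_neg (by simp [h]), h,
          show x = (x.1, 1) from Prod.ext rfl h, cutHeight_of_cutParam_eq_one hφ cutParam_one]
        simp
      · rw [if_neg (not_le.2 h), if_neg (not_lt.2 (h.le.trans (le_abs_self _)))]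
    · have hc : Continuous fun x : Circle × ℝ => if -1 ≤ x.2 then -|cutHeight φ x| else x.2 :=
        Continuous.if_le habs.neg continuous_snd continuous_const continuous_snd fun x hx => by
          rw [show x = (x.1, -1) from Prod.ext rfl hx.symm,
            cutHeight_of_cutParam_eq_one hφ cutParam_neg_one]
          simp
      refine hc.continuousAt.congr ?_
      filter_upwards [hsnd.eventually (eventually_nhdsWithin_iff.1 h1),
        hsnd.eventually (gt_mem_nhds (by norm_num : (-1 : ℝ) < 1))] with x hx hx'
      rcases lt_trichotomy (-1) x.2 with h | h | h
      · rw [if_pos h.le, if_pos (abs_lt.2 ⟨h, hx'⟩), abs_of_neg (hx h x.1), neg_neg]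
      · rw [if_pos h.le, if_neg (by simp [← h]), ← h,
          show x = (x.1, -1) from Prod.ext rfl h.symm,
          cutHeight_of_cutParam_eq_one hφ cutParam_neg_one]
        simp
      · rw [if_neg (not_le.2 h), if_neg (not_lt.2 (le_abs'.2 (Or.inl h.le)))]
  · refine hsnd.congr ?_
    filter_upwards [(hsnd.abs).eventually (lt_mem_nhds ht)] with x hx
    exact (if_neg (not_lt.2 hx.le)).symm

theorem ExtendsOver.of_cutHeight (hφ : ∀ u, φ (u, 1) = (u, 1))
    (h1 : ∀ᶠ t in 𝓝[>] (-1), ∀ u, cutHeight φ (u, t) < 0)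
    (h2 : ∀ᶠ t in 𝓝[<] 1, ∀ u, 0 < cutHeight φ (u, t)) : ExtendsOver φ := by
  refine ExtendsOver.of_cut (continuous_cutMap hφ h1 h2) (cutMap_bijective hφ)
    (fun u t => cutMap_of_one_le_abs hφ) (fun u t ht => ?_) fun u t ht => ?_
  · rw [cutMap_of_abs_lt ht]; exact abs_cutHeight_lt_one hφ ht
  · rcases eq_or_lt_of_le ht with ht | ht
    · rw [cutMap_of_one_le_abs hφ ht.ge]
      rcases eq_or_eq_neg_of_abs_eq ht with rfl | rfl <;> simp [hφ]
    · rw [cutMap_of_abs_lt ht]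
      simp [cutHeight]

theorem cutHeight_trans_inv (hφ : ∀ u, φ (u, 1) = (u, 1)) {u : Circle} {t : ℝ} (ht : |t| < 1) :
    cutHeight (φ.trans ((Homeomorph.refl Circle).prodCongr (Homeomorph.inv Circle))) (u, t) =
      -cutHeight φ (u, t) :=
  cutCoord_inv (snd_ne_one hφ (cutParam_ne_one ht))

/-- A torus homeomorphism that fixes the meridian pointwise extends over the solid torus.  If it
exchanges the two sides of the meridian, it is first composed with a reflection. -/
theorem ExtendsOver.of_fixes_meridian (hφ : ∀ u, φ (u, 1) = (u, 1)) : ExtendsOver φ := by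
  set ι := (Homeomorph.refl Circle).prodCongr (Homeomorph.inv Circle)
  have hφι : ∀ u, φ.trans ι (u, 1) = (u, 1) := fun u => by simp [hφ, ι]
  have e1 : ∀ᶠ t in 𝓝[>] (-1 : ℝ), ∀ u,
      cutHeight (φ.trans ι) (u, t) = -cutHeight φ (u, t) := by
    filter_upwards [Ioo_mem_nhdsGT (by norm_num : (-1 : ℝ) < 1)] with t ht u
    exact cutHeight_trans_inv hφ (abs_lt.2 ht)
  have e2 : ∀ᶠ t in 𝓝[<] (1 : ℝ), ∀ u,
      cutHeight (φ.trans ι) (u, t) = -cutHeight φ (u, t) := by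
    filter_upwards [Ioo_mem_nhdsLT (by norm_num : (-1 : ℝ) < 1)] with t ht u
    exact cutHeight_trans_inv hφ (abs_lt.2 ht)
  rcases cutHeight_sign_left hφ with h1 | h1 <;> rcases cutHeight_sign_right hφ with h2 | h2
  · exact (not_cutHeight_pos_pos hφ h1 h2).elim
  · have h : ExtendsOver (φ.trans ι) := ExtendsOver.of_cutHeight hφι
      (by filter_upwards [h1, e1] with t h e u; rw [e]; exact neg_lt_zero.2 (h u))
      (by filter_upwards [h2, e2] with t h e u; rw [e]; exact neg_pos.2 (h u))
    convert h.trans (ExtendsOver.prodCongr (Homeomorph.refl Circle) (Homeomorph.inv Circle)).symm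
    ext x : 1; simp [ι, Prod.map]
  · exact ExtendsOver.of_cutHeight hφ h1 h2
  · exact (not_cutHeight_pos_pos hφι
      (by filter_upwards [h1, e1] with t h e u; rw [e]; exact neg_pos.2 (h u))
      (by filter_upwards [h2, e2] with t h e u; rw [e]; exact neg_pos.2 (h u))).elim

theorem ExtendsOver.of_image_meridian (hφ : φ '' (univ ×ˢ {1}) = univ ×ˢ {1}) : ExtendsOver φ := by
  have h1 (u : Circle) : (φ (u, 1)).2 = 1 := by
    have : φ (u, 1) ∈ (univ : Set Circle) ×ˢ ({1} : Set Circle) := hφ ▸ mem_image_of_mem φ (by simp)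
    exact this.2
  have h2 (u : Circle) : (φ.symm (u, 1)).2 = 1 := by
    obtain ⟨p, hp, h⟩ : (u, (1 : Circle)) ∈ φ '' (univ ×ˢ {1}) := by rw [hφ]; simp
    rw [← h, Homeomorph.symm_apply_apply]
    exact hp.2
  -- the restriction of `φ` to the meridian
  let α : Circle ≃ₜ Circle :=
    { toFun := fun u => (φ (u, 1)).1
      invFun := fun u => (φ.symm (u, 1)).1
      left_inv := fun u => by
        change (φ.symm ((φ (u, 1)).1, 1)).1 = u
        rw [show ((φ (u, 1)).1, (1 : Circle)) = φ (u, 1) from Prod.ext rfl (h1 u).symm]; simp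
      right_inv := fun u => by
        change (φ ((φ.symm (u, 1)).1, 1)).1 = u
        rw [show ((φ.symm (u, 1)).1, (1 : Circle)) = φ.symm (u, 1) from
          Prod.ext rfl (h2 u).symm]; simp
      continuous_toFun := by fun_prop
      continuous_invFun := by fun_prop }
  have h3 : ExtendsOver (((α.prodCongr (Homeomorph.refl Circle)).symm).trans φ) := by
    refine ExtendsOver.of_fixes_meridian fun u => ?_
    have : φ (α.symm u, 1) = (α (α.symm u), 1) := Prod.ext rfl (h1 _)
    simpa using this
  convert (ExtendsOver.prodCongr α (Homeomorph.refl Circle)).trans h3 using 1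
  ext x : 1; simp [Prod.map]

/-- A torus homeomorphism that takes the meridian to an isotopic curve extends over the solid
torus. -/
theorem ExtendsOver.of_isIsotopic
    (hφ : IsIsotopic (φ '' (univ ×ˢ {1})) (univ ×ˢ {1})) : ExtendsOver φ := by
  obtain ⟨H, hH, h0, h1⟩ := hφ
  have h2 : ExtendsOver (H 1) :=
    ExtendsOver.of_isotopy H hH (Homeomorph.refl Circle) fun p => by simp [h0]
  have h3 : ExtendsOver (φ.trans (H 1)) :=
    ExtendsOver.of_image_meridian ((image_comp (H 1) φ _).trans h1)
  convert h3.trans h2.symm using 1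
  ext x : 1; simp

end

/-! ### Surgery along a homeomorphism of exteriors -/

namespace TubularNbhd

variable {M : Type*} [TopologicalSpace M] {K K' : Knot M}

theorem isClosed_exterior (N : TubularNbhd K) : IsClosed N.exterior :=
  (N.isOpenEmbedding.isOpenMap _ (Metric.isOpen_ball.prod isOpen_univ)).isClosed_compl

theorem mem_boundary_iff (N : TubularNbhd K) {z : ℂ} {w : Circle} :
    N.param (z, w) ∈ N.boundary ↔ ‖z‖ = 1 := by
  constructor
  · rintro ⟨p, hp⟩
    have := congrArg Prod.fst (N.isOpenEmbedding.injective hp)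
    simp only at this
    rw [← this, Circle.norm_coe]
  · intro hz
    exact ⟨(⟨z, mem_sphere_zero_iff_norm.2 hz⟩, w), rfl⟩

theorem param_mem_exterior_iff (N : TubularNbhd K) {z : ℂ} {w : Circle} :
    N.param (z, w) ∈ N.exterior ↔ 1 ≤ ‖z‖ := by
  rw [exterior, mem_compl_iff, N.isOpenEmbedding.injective.mem_set_image]
  simp

theorem exterior_diff_boundary (N : TubularNbhd K) :
    N.exterior \ N.boundary = (N.param '' (Metric.closedBall 0 1 ×ˢ univ))ᶜ := by
  ext x
  rw [mem_compl_iff, ← not_iff_not, not_not, Set.mem_sdiff]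
  constructor
  · intro h
    by_cases hx : x ∈ N.exterior
    · obtain ⟨p, rfl⟩ : x ∈ N.boundary := by tauto
      exact ⟨_, ⟨by simp [Circle.norm_coe], mem_univ _⟩, rfl⟩
    · obtain ⟨p, hp, rfl⟩ := not_not.1 hx
      exact ⟨p, ⟨Metric.ball_subset_closedBall hp.1, mem_univ _⟩, rfl⟩
  · rintro ⟨⟨z, w⟩, hp, rfl⟩ ⟨h1, h2⟩
    rw [mem_boundary_iff] at h2
    rw [param_mem_exterior_iff] at h1
    exact h2 (le_antisymm (mem_closedBall_zero_iff.1 hp.1) h1)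

theorem isOpen_exterior_diff_boundary [T2Space M] (N : TubularNbhd K) :
    IsOpen (N.exterior \ N.boundary) := by
  rw [exterior_diff_boundary, isOpen_compl_iff]
  exact (((isCompact_closedBall _ _).prod isCompact_univ).image
    N.isOpenEmbedding.continuous).isClosed

section

variable {N' : TubularNbhd K'} {N : TubularNbhd K} (h : N'.exterior ≃ₜ N.exterior)
  (hh : ∀ x, (h x : M) ∈ N.boundary ↔ (x : M) ∈ N'.boundary)

/-- The homeomorphism of boundary tori induced by a homeomorphism of exteriors. -/
def boundaryHomeo : N'.boundary ≃ₜ N.boundary where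
  toFun x := ⟨h ⟨x, N'.boundary_subset_exterior x.2⟩, (hh _).2 x.2⟩
  invFun y := ⟨h.symm ⟨y, N.boundary_subset_exterior y.2⟩, by
    rw [← hh, Homeomorph.apply_symm_apply]; exact y.2⟩
  left_inv x := by simp
  right_inv y := by simp

/-- The gluing map on `∂N(K)` that corresponds, under a homeomorphism of exteriors, to the trivial
gluing on `∂N(K')`. -/
noncomputable def transferGluing : N.GluingMap := N'.trivialGluing.trans (boundaryHomeo h hh)

theorem transferGluing_apply (p : Circle × Circle) :
    (⟨transferGluing h hh p, N.boundary_subset_exterior (transferGluing h hh p).2⟩ : N.exterior) =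
      h ⟨N'.boundaryParam p, N'.boundary_subset_exterior ⟨p, rfl⟩⟩ := rfl

/-- The map from the surgered manifold to `M` which is the inverse of the given homeomorphism on the
exterior and the parametrization of `N(K')` on the attached solid torus. -/
def surgeryMap : N.Surgery (transferGluing h hh) → M :=
  Quot.lift (Sum.elim (fun x => (h.symm x : M)) fun s => N'.param (s.1, s.2)) (by
    rintro _ _ ⟨p, rfl, rfl⟩
    simp only [Sum.elim_inl, Sum.elim_inr, transferGluing_apply, Homeomorph.symm_apply_apply]
    rfl)

theorem continuous_surgeryMap : Continuous (surgeryMap h hh) := by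
  refine continuous_quot_lift _ (Continuous.sumElim (by fun_prop) ?_)
  exact N'.isOpenEmbedding.continuous.comp (by fun_prop)

theorem surgeryMap_bijective : Function.Bijective (surgeryMap h hh) := by
  have hmix (x : N.exterior) (s : SolidTorus) (hxs : (h.symm x : M) = N'.param (s.1, s.2)) :
      N.toSurgery (transferGluing h hh) x = Quot.mk _ (Sum.inr s) := by
    obtain ⟨⟨z, hz⟩, w⟩ := s
    simp only at hxs
    have hm : N'.param (z, w) ∈ N'.exterior := by rw [← hxs]; exact (h.symm x).2
    have h1 : 1 ≤ ‖z‖ := N'.param_mem_exterior_iff.1 hm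
    have h2 : ‖z‖ = 1 := le_antisymm (mem_closedBall_zero_iff.1 hz) h1
    refine Quot.sound ⟨(⟨z, mem_sphere_zero_iff_norm.2 h2⟩, w), ?_, rfl⟩
    exact congrArg Sum.inl (h.symm_apply_eq.1 (Subtype.ext hxs : h.symm x = ⟨_, hm⟩))
  constructor
  · rintro ⟨x | s⟩ ⟨y | t⟩ hxy
    · rw [h.symm.injective (Subtype.ext hxy)]
    · exact hmix x t hxy
    · exact (hmix y s hxy.symm).symm
    · have := N'.isOpenEmbedding.injective hxy
      rw [Prod.mk.injEq] at this
      rw [Prod.ext (Subtype.ext this.1) this.2]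
  · intro y
    by_cases hy : y ∈ N'.exterior
    · exact ⟨N.toSurgery _ (h ⟨y, hy⟩), by simp [toSurgery, surgeryMap]⟩
    · obtain ⟨p, hp, rfl⟩ := not_not.1 hy
      exact ⟨Quot.mk _ (Sum.inr (⟨p.1, Metric.ball_subset_closedBall hp.1⟩, p.2)), rfl⟩

/-- Surgery along the transferred gluing map gives back `M`. -/
noncomputable def surgeryHomeo [T2Space M] [CompactSpace M] :
    N.Surgery (transferGluing h hh) ≃ₜ M :=
  haveI : CompactSpace N.exterior := isCompact_iff_compactSpace.1 N.isClosed_exterior.isCompact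
  Continuous.homeoOfEquivCompactToT2 (f := Equiv.ofBijective _ (surgeryMap_bijective h hh))
    (continuous_surgeryMap h hh)

theorem surgeryHomeo_toSurgery [T2Space M] [CompactSpace M] (x : N.exterior) :
    surgeryHomeo h hh (N.toSurgery _ x) = h.symm x := rfl

theorem surgeryHomeo_inr [T2Space M] [CompactSpace M] (s : SolidTorus) :
    surgeryHomeo h hh (Quot.mk _ (Sum.inr s)) = N'.param (s.1, s.2) := rfl

open Classical in
/-- A homeomorphism of exteriors, restricted to their interiors and regarded as a local
homeomorphism of `M`; outside the exteriors the value is a dummy. -/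
noncomputable def interiorHomeo [T2Space M] : OpenPartialHomeomorph M M where
  toFun x := if hx : x ∈ N'.exterior then h ⟨x, hx⟩ else x
  invFun y := if hy : y ∈ N.exterior then h.symm ⟨y, hy⟩ else y
  source := N'.exterior \ N'.boundary
  target := N.exterior \ N.boundary
  map_source' x hx := by
    simp only [hx.1, dite_true]
    exact ⟨(h ⟨x, hx.1⟩).2, fun h' => hx.2 ((hh _).1 h')⟩
  map_target' y hy := by
    simp only [hy.1, dite_true]
    refine ⟨(h.symm ⟨y, hy.1⟩).2, fun h' => hy.2 ?_⟩
    rw [← hh, Homeomorph.apply_symm_apply] at h'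
    exact h'
  left_inv' x hx := by simp [hx.1]
  right_inv' y hy := by simp [hy.1]
  open_source := N'.isOpen_exterior_diff_boundary
  open_target := N.isOpen_exterior_diff_boundary
  continuousOn_toFun := by
    refine ContinuousOn.mono ?_ sdiff_subset
    rw [continuousOn_iff_continuous_domRestrict]
    convert continuous_subtype_val.comp h.continuous using 1
    funext x
    simp
  continuousOn_invFun := by
    refine ContinuousOn.mono ?_ sdiff_subset
    rw [continuousOn_iff_continuous_domRestrict]
    convert continuous_subtype_val.comp h.symm.continuous using 1
    funext x
    simp

theorem interiorHomeo_apply [T2Space M] (x : N'.exterior) : interiorHomeo h hh x = h x := by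
  simp [interiorHomeo]

theorem interiorHomeo_symm_apply [T2Space M] (y : N.exterior) :
    (interiorHomeo h hh).symm y = h.symm y := by
  simp [interiorHomeo]

theorem preservesOrientationAt_iff_interiorHomeo [T2Space M] {o : OrientedAtlas M}
    {x : N'.exterior} (hx : (x : M) ∉ N'.boundary) :
    PreservesOrientationAt o o Subtype.val (fun y => (h y : M)) x ↔
      LocallyPreserves o o (interiorHomeo h hh) x := by
  refine preservesOrientationAt_iff Subtype.val_injective ?_ (Eventually.of_forall ?_)
  · rw [Subtype.range_coe]
    exact mem_of_superset (N'.isOpen_exterior_diff_boundary.mem_nhds ⟨x.2, hx⟩) sdiff_subset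
  · rintro _ w rfl
    exact (interiorHomeo_apply h hh w).symm

theorem preservesOrientationAt_symm_iff_interiorHomeo [T2Space M] {o : OrientedAtlas M}
    {y : N.exterior} (hy : (y : M) ∉ N.boundary) :
    PreservesOrientationAt o o Subtype.val (fun y => (h.symm y : M)) y ↔
      LocallyPreserves o o (interiorHomeo h hh).symm y := by
  refine preservesOrientationAt_iff Subtype.val_injective ?_ (Eventually.of_forall ?_)
  · rw [Subtype.range_coe]
    exact mem_of_superset (N.isOpen_exterior_diff_boundary.mem_nhds ⟨y.2, hy⟩) sdiff_subset
  · rintro _ w rfl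
    exact (interiorHomeo_symm_apply h hh w).symm

end

/-- The knot `K'` has a regular neighbourhood with exterior orientation-preservingly homeomorphic to
that of `N`, such that `r` is the slope on `∂N(K)` that corresponds to the meridian of `K'`. -/
def HasMeridianSlope (o : OrientedAtlas M) (N : TubularNbhd K) (K' : Knot M) (r : N.Slope) : Prop :=
  ∃ (N' : TubularNbhd K') (h : N'.exterior ≃ₜ N.exterior)
    (hh : ∀ x, (h x : M) ∈ N.boundary ↔ (x : M) ∈ N'.boundary),
    (∀ x : N'.exterior, (x : M) ∉ N'.boundary →
      PreservesOrientationAt o o Subtype.val (fun y => (h y : M)) x) ∧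
      (transferGluing h hh).slope = r

theorem hasMeridianSlope_self [T2Space M] (o : OrientedAtlas M) (N : TubularNbhd K) :
    HasMeridianSlope o N K N.meridionalSlope := by
  refine ⟨N, Homeomorph.refl _, fun x => Iff.rfl, fun x hx => ?_, rfl⟩
  refine (preservesOrientationAt_iff (θ := OpenPartialHomeomorph.refl M) Subtype.val_injective ?_
    (Eventually.of_forall fun y w hw => hw)).2 (locallyPreserves_refl _)
  rw [Subtype.range_coe]
  exact mem_of_superset (N.isOpen_exterior_diff_boundary.mem_nhds ⟨x.2, hx⟩) sdiff_subset

/-- Surgery on `K` along the meridian of a knot with the same exterior yields the ambient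
manifold. -/
theorem HasMeridianSlope.surgeryYieldsAmbient [T2Space M] [CompactSpace M] {o : OrientedAtlas M}
    {N : TubularNbhd K} {r : N.Slope} (H : HasMeridianSlope o N K' r) :
    N.SurgeryYieldsAmbient o r := by
  obtain ⟨N', h, hh, hop, rfl⟩ := H
  refine ⟨_, rfl, o.pullback (surgeryHomeo h hh), fun y hy => ?_, surgeryHomeo h hh,
    o.orientationPreserving_pullback _⟩
  rw [OrientedAtlas.preservesOrientationAt_pullback]
  refine (preservesOrientationAt_symm_iff_interiorHomeo h hh hy).2 ?_
  obtain ⟨x, rfl⟩ := h.surjective y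
  have hx : (x : M) ∉ N'.boundary := fun h' => hy ((hh x).2 h')
  rw [← interiorHomeo_apply h hh]
  exact LocallyPreserves.symm ⟨x.2, hx⟩
    ((preservesOrientationAt_iff_interiorHomeo h hh hx).1 (hop x hx))

/-- Surgeries whose gluing maps differ by a homeomorphism that extends over the solid torus are
homeomorphic. -/
noncomputable def surgeryCongr {N : TubularNbhd K} {f₁ f₂ : N.GluingMap}
    (Φ : SolidTorus ≃ₜ SolidTorus)
    (hΦ : ∀ p, Φ (solidTorusBoundary p) = solidTorusBoundary (f₂.symm (f₁ p))) :
    N.Surgery f₁ ≃ₜ N.Surgery f₂ where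
  toFun := Quot.map (Sum.map id Φ) (by
    rintro _ _ ⟨p, rfl, rfl⟩
    exact ⟨f₂.symm (f₁ p), by simp, by simp [hΦ]⟩)
  invFun := Quot.map (Sum.map id Φ.symm) (by
    rintro _ _ ⟨p, rfl, rfl⟩
    refine ⟨f₁.symm (f₂ p), by simp, ?_⟩
    simp [Homeomorph.symm_apply_eq, hΦ])
  left_inv := by rintro ⟨x | s⟩ <;> simp [Quot.map]
  right_inv := by rintro ⟨x | s⟩ <;> simp [Quot.map]
  continuous_toFun := continuous_quot_lift _ (continuous_quot_mk.comp (by fun_prop))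
  continuous_invFun := continuous_quot_lift _ (continuous_quot_mk.comp (by fun_prop))

theorem IsIsotopic.image {T T' : Type*} [TopologicalSpace T] [TopologicalSpace T'] {C C' : Set T}
    (h : IsIsotopic C C') (e : T ≃ₜ T') : IsIsotopic (e '' C) (e '' C') := by
  obtain ⟨H, hH, h0, rfl⟩ := h
  refine ⟨fun t => (e.symm.trans (H t)).trans e, ?_, ?_, ?_⟩
  · exact e.continuous.comp (hH.comp (by fun_prop : Continuous
      fun p : unitInterval × T' => (p.1, e.symm p.2)))
  · ext x; simp [h0]
  · ext x; simp

theorem extendsOver_of_slope_eq {N : TubularNbhd K} {f₁ f₂ : N.GluingMap}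
    (h : f₁.slope = f₂.slope) : ExtendsOver (f₁.trans f₂.symm) := by
  have h1 : IsIsotopic f₁.meridianImage f₂.meridianImage := Quotient.exact h
  have h2 := IsIsotopic.image h1 f₂.symm
  refine ExtendsOver.of_isIsotopic ?_
  convert h2 using 1
  · exact image_comp f₂.symm f₁ _
  · rw [GluingMap.meridianImage, image_image]
    simp

/-- Knots with the same exterior whose meridians have the same slope are equivalent. -/
theorem HasMeridianSlope.equivalent [T2Space M] [CompactSpace M] {o : OrientedAtlas M}
    {N : TubularNbhd K} {K₁ K₂ : Knot M} {r : N.Slope} (H₁ : HasMeridianSlope o N K₁ r)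
    (H₂ : HasMeridianSlope o N K₂ r) : K₁.Equivalent o K₂ := by
  obtain ⟨N₁, h₁, hh₁, hop₁, hr₁⟩ := H₁
  obtain ⟨N₂, h₂, hh₂, hop₂, hr₂⟩ := H₂
  obtain ⟨Φ, hΦ, hΦ0⟩ := extendsOver_of_slope_eq (hr₁.trans hr₂.symm)
  let g : M ≃ₜ M := ((surgeryHomeo h₁ hh₁).symm.trans
    (surgeryCongr (f₂ := transferGluing h₂ hh₂) Φ hΦ)).trans (surgeryHomeo h₂ hh₂)
  have hg_ext (x : N₁.exterior) : g x = h₂.symm (h₁ x) := by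
    have : (surgeryHomeo h₁ hh₁).symm x = N.toSurgery _ (h₁ x) := by
      rw [Homeomorph.symm_apply_eq, surgeryHomeo_toSurgery, Homeomorph.symm_apply_apply]
    simp only [g, Homeomorph.trans_apply, this]
    rfl
  have hg_torus (s : SolidTorus) : g (N₁.param (s.1, s.2)) = N₂.param ((Φ s).1, (Φ s).2) := by
    have : (surgeryHomeo h₁ hh₁).symm (N₁.param (s.1, s.2)) = Quot.mk _ (Sum.inr s) := by
      rw [Homeomorph.symm_apply_eq, surgeryHomeo_inr]
    simp only [g, Homeomorph.trans_apply, this]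
    rfl
  -- the orientation is preserved in the interior of the exterior
  have hint (x : M) (hx : x ∈ N₁.exterior \ N₁.boundary) :
      LocallyPreserves o o g.toOpenPartialHomeomorph x := by
    have h3 := (preservesOrientationAt_iff_interiorHomeo h₁ hh₁ (x := ⟨x, hx.1⟩) hx.2).1
      (hop₁ _ hx.2)
    have hx1 : interiorHomeo h₁ hh₁ x ∈ N.exterior \ N.boundary :=
      (interiorHomeo h₁ hh₁).map_source hx
    obtain ⟨y, hy, hyx⟩ : ∃ y ∈ N₂.exterior \ N₂.boundary,
        interiorHomeo h₂ hh₂ y = interiorHomeo h₁ hh₁ x :=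
      ⟨_, (interiorHomeo h₂ hh₂).map_target hx1, (interiorHomeo h₂ hh₂).right_inv hx1⟩
    have h4 := LocallyPreserves.symm hy
      ((preservesOrientationAt_iff_interiorHomeo h₂ hh₂ (x := ⟨y, hy.1⟩) hy.2).1 (hop₂ _ hy.2))
    rw [hyx] at h4
    refine (locallyPreserves_congr ?_).1 (LocallyPreserves.trans hx hx1 h3 h4)
    filter_upwards [N₁.isOpen_exterior_diff_boundary.mem_nhds hx] with z hz
    have e1 := interiorHomeo_apply h₁ hh₁ ⟨z, hz.1⟩
    simp only at e1
    change (interiorHomeo h₂ hh₂).symm (interiorHomeo h₁ hh₁ z) = g z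
    rw [e1, interiorHomeo_symm_apply, hg_ext ⟨z, hz.1⟩]
  refine ⟨g, (orientationPreserving_iff g).2 fun x => ?_, ?_⟩
  · by_cases hx : x ∈ N₁.exterior \ N₁.boundary
    · exact hint x hx
    · -- the open solid torus is connected and meets the interior of the exterior
      have h2 : N₁.param (2, 1) ∈ N₁.exterior \ N₁.boundary := by
        rw [Set.mem_sdiff, mem_boundary_iff, param_mem_exterior_iff]; norm_num
      rw [exterior_diff_boundary, mem_compl_iff, not_not] at hx
      obtain ⟨p, -, rfl⟩ := hx
      exact LocallyPreserves.of_isPreconnected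
        (isPreconnected_range N₁.isOpenEmbedding.continuous) (mem_range_self _) (mem_range_self _)
        (hint _ h2)
  · rw [← N₁.core, ← N₂.core]
    have h0 : ‖(0 : ℂ)‖ ≤ 1 := by simp
    ext y
    constructor
    · rintro ⟨_, ⟨⟨z, w⟩, ⟨rfl, -⟩, rfl⟩, rfl⟩
      have := hg_torus (⟨0, mem_closedBall_zero_iff.2 h0⟩, w)
      simp only at this
      rw [this]
      exact ⟨_, mk_mem_prod (mem_singleton_iff.2 ((hΦ0 _).2 rfl)) (mem_univ _), rfl⟩
    · rintro ⟨⟨z, w⟩, ⟨rfl, -⟩, rfl⟩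
      obtain ⟨s, hs⟩ := Φ.surjective (⟨0, mem_closedBall_zero_iff.2 h0⟩, w)
      have := hg_torus s
      rw [hs] at this
      exact ⟨_, ⟨_, mk_mem_prod (mem_singleton_iff.2 ((hΦ0 s).1 (by rw [hs]))) (mem_univ _), rfl⟩,
        this⟩

end TubularNbhd

end KnotSurgery

theorem mainTheorem9 {M : Type*} [TopologicalSpace M] [T2Space M] [CompactSpace M]
    [ChartedSpace (EuclideanSpace ℝ (Fin 3)) M] (o : KnotSurgery.OrientedAtlas M)
    (K : KnotSurgery.Knot M) (N : KnotSurgery.TubularNbhd K) (k : ℕ)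
    (hk : {r : N.Slope | r ≠ N.meridionalSlope ∧ N.SurgeryYieldsAmbient o r}.encard ≤ k)
    (S : Set (KnotSurgery.Knot M))
    (hS : ∀ K' ∈ S, ¬ KnotSurgery.Knot.Equivalent o K' K ∧
      ∃ N' : KnotSurgery.TubularNbhd K', N'.ExteriorsHomeomorphic o N)
    (hS' : S.Pairwise fun K₁ K₂ => ¬ KnotSurgery.Knot.Equivalent o K₁ K₂) :
    S.encard ≤ k := by
  have : Nonempty N.Slope := ⟨N.meridionalSlope⟩
  have h : ∀ K' ∈ S, ∃ r : N.Slope, KnotSurgery.TubularNbhd.HasMeridianSlope o N K' r := by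
    intro K' hK'
    obtain ⟨-, N', h, hh, hop⟩ := hS K' hK'
    exact ⟨_, N', h, hh, hop, rfl⟩
  choose! r hr using h
  have hmaps : MapsTo r S {r | r ≠ N.meridionalSlope ∧ N.SurgeryYieldsAmbient o r} :=
    fun K' hK' => ⟨fun h => (hS K' hK').1 ((hr K' hK').equivalent
      (h ▸ KnotSurgery.TubularNbhd.hasMeridianSlope_self o N)), (hr K' hK').surgeryYieldsAmbient⟩
  have hinj : InjOn r S := by
    intro K₁ h₁ K₂ h₂ h
    by_contra hne
    exact hS' h₁ h₂ hne ((hr K₁ h₁).equivalent (h ▸ hr K₂ h₂))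
  exact (encard_le_encard_of_injOn hmaps hinj).trans hk
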